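/- All vector spaces are over $\mathbb C$, and $\lambda$ runs over $\mathbb C\setminus\{0\}$. **Graded algebras.** Consider associative unital graded algebras $\mathcal A=(\mathcal A_t)_{t=0,1,2,\dots}$ with $\mathcal A_0=\mathbb C$ such that, for all $s,t\in\{1,2,\dots\}$, the space $\mathcal A_t$ is two-dimensional and the multiplication map $\mathcal A_s\otimes\mathcal A_t\to\mathcal A_{s+t}$ is surjective. An isomorphism $\mathcal A\to\mathcal B$ is a family of invertible linear maps $\theta_t:\mathcal A_t\to\mathcal B_t$ preserving the unit and all products. Let $\mathcal B_1,\mathcal B_2,\mathcal B_3(\lambda),\mathcal B_4,\mathcal B_5$ have the components $\mathbb C$ in degree $0$ and $\mathbb C^2$ in each degree $t\ge1$, where degree $0$ acts by scalar multiplication and, for $s,t\ge1$, the product of $(a_1,a_2)$ in degree $s$ and $(b_1,b_2)$ in degree $t$ is $(c_1,c_2)$ in degree $s+t$, with - $\mathcal B_1$: $c_1=a_1b_1,\ c_2=a_2b_2$; - $\mathcal B_2$: $c_1=a_1b_1,\ c_2=a_2b_2$ if $s$ is even; $c_1=a_1b_2,\ c_2=a_2b_1$ if $s$ is odd; - $\mathcal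 B_3(\lambda)$: $c_1=a_1b_1,\ c_2=a_2b_1+\lambda^s a_1b_2$; - $\mathcal B_4$: $c_1=a_1b_1,\ c_2=a_2b_1$; - $\mathcal B_5$: $c_1=a_1b_1,\ c_2=a_1b_2$. Then all of these are graded algebras of the kind considered, they are pairwise non-isomorphic (in particular $\mathcal B_3(\lambda)\not\cong\mathcal B_3(\mu)$ for $\lambda\ne\mu$), and every graded algebra of this kind is isomorphic to one and only one of them. **Subproduct systems.** A subproduct system consists of two-dimensional spaces $E_t$ ($t=1,2,\dots$) and injective linear maps $\beta_{s,t}:E_{s+t}\to E_s\otimes E_t$ ($s,t\ge1$) such that $(\beta_{r,s}\otimes 1)\beta_{r+s,t}=(1\otimes\beta_{s,t})\beta_{r,s+t}$ for all $r,s,t\ge1$. An isomorphism of subproduct systems is a family of invertible linear maps $\theta_t$ between the corresponding spaces with $\beta'_{s,t}\theta_{s+t}=(\theta_s\otimes\theta_t)\beta_{s,t}$. Let $\mathcal E_1,\mathcal E_2,\mathcal E_3(\lambda),\mathcal E_4,\mathcal E_5$ have $E_t=\mathbb C^2$ for all $t\ge1$ and, with $e_1=(1,0)$, $e_2=(0,1)$,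 - $\mathcal E_1$: $\beta_{s,t}(e_1)=e_1\otimes e_1,\ \beta_{s,t}(e_2)=e_2\otimes e_2$; - $\mathcal E_2$: $\beta_{s,t}(e_1)=e_1\otimes e_1,\ \beta_{s,t}(e_2)=e_2\otimes e_2$ if $s$ is even; $\beta_{s,t}(e_1)=e_1\otimes e_2,\ \beta_{s,t}(e_2)=e_2\otimes e_1$ if $s$ is odd; - $\mathcal E_3(\lambda)$: $\beta_{s,t}(e_1)=e_1\otimes e_1,\ \beta_{s,t}(e_2)=e_2\otimes e_1+\lambda^s e_1\otimes e_2$; - $\mathcal E_4$: $\beta_{s,t}(e_1)=e_1\otimes e_1,\ \beta_{s,t}(e_2)=e_2\otimes e_1$; - $\mathcal E_5$: $\beta_{s,t}(e_1)=e_1\otimes e_1,\ \beta_{s,t}(e_2)=e_1\otimes e_2$. Then these are subproduct systems, they are pairwise non-isomorphic, and every subproduct system is isomorphic to one and only one of them. -/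

import Mathlib

open scoped TensorProduct

universe u v

/-! ### Graded algebras

A graded `ℂ`-algebra is a family `A : ℕ → Type u` of complex vector spaces with the structure
`DirectSum.GRing A`, `DirectSum.GAlgebra ℂ A`. -/

/-- `A 0 = ℂ`, every `A t` with `t ≥ 1` is two-dimensional, and every multiplication map
`A s ⊗ A t → A (s + t)` with `s, t ≥ 1` is surjective. -/
structure IsTwoDimGradedAlgebra (A : ℕ → Type u) [∀ n, AddCommGroup (A n)]
    [∀ n, Module ℂ (A n)] [DirectSum.GRing A] [DirectSum.GAlgebra ℂ A] : Prop where
  zero_bijective :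
    Function.Bijective (DirectSum.GAlgebra.toFun : ℂ →+ A 0)
  finrank_eq_two : ∀ t : ℕ, 1 ≤ t → Module.finrank ℂ (A t) = 2
  mul_surjective : ∀ s t : ℕ, 1 ≤ s → 1 ≤ t →
    Function.Surjective
      (TensorProduct.lift (DirectSum.gMulLHom ℂ A : A s →ₗ[ℂ] A t →ₗ[ℂ] A (s + t)))

/-- Isomorphisms of graded `ℂ`-algebras: degree-wise invertible linear maps that preserve the
unit and the multiplication. -/
structure GradedAlgebraIso (A : ℕ → Type u) (B : ℕ → Type v)
    [∀ n, AddCommGroup (A n)] [∀ n, Module ℂ (A n)] [DirectSum.GRing A]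
    [DirectSum.GAlgebra ℂ A]
    [∀ n, AddCommGroup (B n)] [∀ n, Module ℂ (B n)] [DirectSum.GRing B]
    [DirectSum.GAlgebra ℂ B] where
  toEquiv : ∀ n, A n ≃ₗ[ℂ] B n
  map_one : toEquiv 0 GradedMonoid.GOne.one = GradedMonoid.GOne.one
  map_mul : ∀ (s t : ℕ) (x : A s) (y : A t),
    toEquiv (s + t) (GradedMonoid.GMul.mul x y) =
      GradedMonoid.GMul.mul (toEquiv s x) (toEquiv t y)

/-- The labels `1`, `2`, `3(l)` with `l ≠ 0`, `4`, `5` of the list of standard objects. -/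
inductive StdLabel : Type
  | one
  | two
  | three (l : ℂˣ)
  | four
  | five

/-- The product of `a` (of degree `s ≥ 1`) and `b` (of degree `t ≥ 1`); it depends on the degree
`s` only. -/
noncomputable def stdMul : StdLabel → ℕ → ℂ × ℂ → ℂ × ℂ → ℂ × ℂ
  | .one, _, a, b => (a.1 * b.1, a.2 * b.2)
  | .two, s, a, b => if Even s then (a.1 * b.1, a.2 * b.2) else (a.1 * b.2, a.2 * b.1)
  | .three l, s, a, b => (a.1 * b.1, a.2 * b.1 + (l : ℂ) ^ s * (a.1 * b.2))
  | .four, _, a, b => (a.1 * b.1, a.2 * b.1)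
  | .five, _, a, b => (a.1 * b.1, a.1 * b.2)

theorem stdMul_add_left (i : StdLabel) (s : ℕ) (a a' b : ℂ × ℂ) :
    stdMul i s (a + a') b = stdMul i s a b + stdMul i s a' b := by
  cases i <;> simp only [stdMul] <;> (try split_ifs) <;> ext <;> simp <;> ring

theorem stdMul_add_right (i : StdLabel) (s : ℕ) (a b b' : ℂ × ℂ) :
    stdMul i s a (b + b') = stdMul i s a b + stdMul i s a b' := by
  cases i <;> simp only [stdMul] <;> (try split_ifs) <;> ext <;> simp <;> ring

theorem stdMul_smul_left (i : StdLabel) (s : ℕ) (c : ℂ) (a b : ℂ × ℂ) :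
    stdMul i s (c • a) b = c • stdMul i s a b := by
  cases i <;> simp only [stdMul] <;> (try split_ifs) <;> ext <;> simp <;> ring

theorem stdMul_smul_right (i : StdLabel) (s : ℕ) (c : ℂ) (a b : ℂ × ℂ) :
    stdMul i s a (c • b) = c • stdMul i s a b := by
  cases i <;> simp only [stdMul] <;> (try split_ifs) <;> ext <;> simp <;> ring

theorem stdMul_zero_left (i : StdLabel) (s : ℕ) (b : ℂ × ℂ) : stdMul i s 0 b = 0 := by
  simpa using stdMul_smul_left i s 0 0 b

theorem stdMul_zero_right (i : StdLabel) (s : ℕ) (a : ℂ × ℂ) : stdMul i s a 0 = 0 := by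
  simpa using stdMul_smul_right i s 0 a 0

theorem stdMul_assoc (i : StdLabel) (r s : ℕ) (a b c : ℂ × ℂ) :
    stdMul i (r + s) (stdMul i r a b) c = stdMul i r a (stdMul i s b c) := by
  cases i <;> simp only [stdMul]
  case two =>
    by_cases hr : Even r <;> by_cases hs : Even s <;> simp [Nat.even_add, hr, hs, mul_assoc]
  all_goals ext <;> simp [pow_add] <;> ring

/-- The homogeneous components of the standard graded algebras: `ℂ` in degree `0` and `ℂ²` in
every positive degree. -/
def StdAlg (_ : StdLabel) : ℕ → Type
  | 0 => ℂ
  | _ + 1 => ℂ × ℂ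

namespace StdAlg

noncomputable instance instAddCommGroup (i : StdLabel) : ∀ n, AddCommGroup (StdAlg i n)
  | 0 => inferInstanceAs (AddCommGroup ℂ)
  | _ + 1 => inferInstanceAs (AddCommGroup (ℂ × ℂ))

noncomputable instance instModule (i : StdLabel) : ∀ n, Module ℂ (StdAlg i n)
  | 0 => inferInstanceAs (Module ℂ ℂ)
  | _ + 1 => inferInstanceAs (Module ℂ (ℂ × ℂ))

/-- Multiplication: scalars in degree `0` act by scalar multiplication, and the product of
elements of positive degrees is given by `stdMul`. -/
noncomputable def mul (i : StdLabel) :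
    ∀ {s t : ℕ}, StdAlg i s → StdAlg i t → StdAlg i (s + t)
  | 0, 0 => (fun a b => a * b : ℂ → ℂ → ℂ)
  | 0, _ + 1 => (fun a b => a • b : ℂ → ℂ × ℂ → ℂ × ℂ)
  | _ + 1, 0 => (fun a b => b • a : ℂ × ℂ → ℂ → ℂ × ℂ)
  | s + 1, _ + 1 => (fun a b => stdMul i (s + 1) a b : ℂ × ℂ → ℂ × ℂ → ℂ × ℂ)

theorem mk_succ_eq (i : StdLabel) {m n : ℕ} (h : m = n) {a b : ℂ × ℂ} (hab : a = b) :
    (GradedMonoid.mk (m + 1) (a : StdAlg i (m + 1)) : GradedMonoid (StdAlg i)) =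
      GradedMonoid.mk (n + 1) (b : StdAlg i (n + 1)) := by
  subst h; subst hab; rfl

theorem mul_add' (i : StdLabel) : ∀ {s t : ℕ} (a : StdAlg i s) (b c : StdAlg i t),
    mul i a (b + c) = mul i a b + mul i a c
  | 0, 0, a, b, c => _root_.mul_add (R := ℂ) a b c
  | 0, _ + 1, a, b, c => smul_add (M := ℂ) (A := ℂ × ℂ) a b c
  | _ + 1, 0, a, b, c => add_smul (R := ℂ) (M := ℂ × ℂ) b c a
  | s + 1, _ + 1, a, b, c => stdMul_add_right i (s + 1) a b c

theorem add_mul' (i : StdLabel) : ∀ {s t : ℕ} (a b : StdAlg i s) (c : StdAlg i t),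
    mul i (a + b) c = mul i a c + mul i b c
  | 0, 0, a, b, c => _root_.add_mul (R := ℂ) a b c
  | 0, _ + 1, a, b, c => add_smul (R := ℂ) (M := ℂ × ℂ) a b c
  | _ + 1, 0, a, b, c => smul_add (M := ℂ) (A := ℂ × ℂ) c a b
  | s + 1, _ + 1, a, b, c => stdMul_add_left i (s + 1) a b c

theorem mul_zero' (i : StdLabel) {s t : ℕ} (a : StdAlg i s) :
    mul i a (0 : StdAlg i t) = 0 := by
  have h := mul_add' i a (0 : StdAlg i t) 0
  rw [add_zero] at h
  simpa using h

theorem zero_mul' (i : StdLabel) {s t : ℕ} (b : StdAlg i t) :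
    mul i (0 : StdAlg i s) b = 0 := by
  have h := add_mul' i (0 : StdAlg i s) 0 b
  rw [add_zero] at h
  simpa using h

theorem one_mul' (i : StdLabel) : ∀ {t : ℕ} (a : StdAlg i t),
    (GradedMonoid.mk (0 + t) (mul i (s := 0) (1 : ℂ) a) : GradedMonoid (StdAlg i)) =
      GradedMonoid.mk t a
  | 0, a => congrArg (GradedMonoid.mk (A := StdAlg i) 0) (one_mul (M := ℂ) a)
  | n + 1, a => mk_succ_eq i (zero_add n) (one_smul ℂ (a : ℂ × ℂ))

theorem mul_one' (i : StdLabel) : ∀ {t : ℕ} (a : StdAlg i t),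
    (GradedMonoid.mk (t + 0) (mul i (t := 0) a (1 : ℂ)) : GradedMonoid (StdAlg i)) =
      GradedMonoid.mk t a
  | 0, a => congrArg (GradedMonoid.mk (A := StdAlg i) 0) (mul_one (M := ℂ) a)
  | n + 1, a => mk_succ_eq i (add_zero n) (one_smul ℂ (a : ℂ × ℂ))

theorem mul_assoc' (i : StdLabel) : ∀ {r s t : ℕ}
    (a : StdAlg i r) (b : StdAlg i s) (c : StdAlg i t),
    (GradedMonoid.mk (r + s + t) (mul i (mul i a b) c) : GradedMonoid (StdAlg i)) =
      GradedMonoid.mk (r + (s + t)) (mul i a (mul i b c))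
  | 0, 0, 0, a, b, c =>
      congrArg (GradedMonoid.mk (A := StdAlg i) 0) (_root_.mul_assoc (G := ℂ) a b c)
  | 0, 0, t + 1, a, b, c =>
      mk_succ_eq i (Nat.succ.inj (Nat.add_assoc 0 0 (t + 1)))
        (mul_smul (α := ℂ) (β := ℂ × ℂ) a b c)
  | 0, s + 1, 0, a, b, c =>
      mk_succ_eq i (Nat.succ.inj (Nat.add_assoc 0 (s + 1) 0))
        (smul_comm (M := ℂ) (N := ℂ) (α := ℂ × ℂ) c a b)
  | r + 1, 0, 0, a, b, c =>
      mk_succ_eq i (Nat.succ.inj (Nat.add_assoc (r + 1) 0 0))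
        ((smul_smul (M := ℂ) (α := ℂ × ℂ) c b a).trans
          (congrArg (fun z : ℂ => z • (show ℂ × ℂ from a)) (mul_comm (G := ℂ) c b)))
  | 0, s + 1, t + 1, a, b, c =>
      mk_succ_eq i (Nat.succ.inj (Nat.add_assoc 0 (s + 1) (t + 1)))
        ((congrArg (fun k => stdMul i k _ c) (Nat.zero_add (s + 1))).trans
          (stdMul_smul_left i (s + 1) a b c))
  | r + 1, 0, t + 1, a, b, c =>
      mk_succ_eq i (Nat.succ.inj (Nat.add_assoc (r + 1) 0 (t + 1)))
        ((stdMul_smul_left i (r + 1) b a c).trans (stdMul_smul_right i (r + 1) b a c).symm)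
  | r + 1, s + 1, 0, a, b, c =>
      mk_succ_eq i (Nat.succ.inj (Nat.add_assoc (r + 1) (s + 1) 0))
        (stdMul_smul_right i (r + 1) c a b).symm
  | r + 1, s + 1, t + 1, a, b, c =>
      mk_succ_eq i (Nat.succ.inj (Nat.add_assoc (r + 1) (s + 1) (t + 1)))
        (stdMul_assoc i (r + 1) (s + 1) a b c)

noncomputable instance instGMul (i : StdLabel) : GradedMonoid.GMul (StdAlg i) where
  mul := mul i

noncomputable instance instGOne (i : StdLabel) : GradedMonoid.GOne (StdAlg i) where
  one := (1 : ℂ)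

noncomputable instance instGRing (i : StdLabel) : DirectSum.GRing (StdAlg i) where
  mul := mul i
  one := (1 : ℂ)
  mul_zero := mul_zero' i
  zero_mul := zero_mul' i
  mul_add := mul_add' i
  add_mul := add_mul' i
  one_mul := fun a => one_mul' i a.2
  mul_one := fun a => mul_one' i a.2
  mul_assoc := fun a b c => mul_assoc' i a.2 b.2 c.2
  natCast := fun n => (n : ℂ)
  natCast_zero := Nat.cast_zero (R := ℂ)
  natCast_succ := fun n => Nat.cast_succ (R := ℂ) n
  intCast := fun n => (n : ℂ)
  intCast_ofNat := fun n => Int.cast_natCast (R := ℂ) n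
  intCast_negSucc_ofNat := fun n => Int.cast_negSucc (R := ℂ) n

noncomputable instance instGAlgebra (i : StdLabel) : DirectSum.GAlgebra ℂ (StdAlg i) where
  toFun := AddMonoidHom.id ℂ
  map_one := rfl
  map_mul := fun _ _ => rfl
  commutes := by
    rintro r ⟨_ | n, x⟩
    · exact congrArg (GradedMonoid.mk (A := StdAlg i) 0) (mul_comm (G := ℂ) r x)
    · exact mk_succ_eq i (Nat.zero_add n) rfl
  smul_def := by
    rintro r ⟨_ | n, x⟩
    · rfl
    · exact mk_succ_eq i (Nat.zero_add n).symm rfl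

end StdAlg

/-! ### Subproduct systems -/

/-- A discrete-time subproduct system of two-dimensional complex vector spaces. -/
structure SubproductSystem where
  E : ℕ+ → Type u
  [addCommGroup : ∀ t, AddCommGroup (E t)]
  [module : ∀ t, Module ℂ (E t)]
  finrank_eq_two : ∀ t, Module.finrank ℂ (E t) = 2
  β : ∀ s t : ℕ+, E (s + t) →ₗ[ℂ] E s ⊗[ℂ] E t
  injective : ∀ s t, Function.Injective (β s t)
  /-- Associativity; the `cast` identifies `E ((r + s) + t)` with `E (r + (s + t))`, and
  `TensorProduct.assoc` identifies the two triple tensor products. -/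
  assoc : ∀ (r s t : ℕ+) (x : E (r + s + t)),
    TensorProduct.assoc ℂ (E r) (E s) (E t) ((β r s).rTensor (E t) (β (r + s) t x)) =
      (β s t).lTensor (E r) (β r (s + t) (cast (congrArg E (add_assoc r s t)) x))

attribute [instance] SubproductSystem.addCommGroup SubproductSystem.module

/-- Isomorphisms of subproduct systems: invertible linear maps `E_t → F_t` compatible with the
structure maps. -/
structure SubproductSystemIso (S : SubproductSystem.{u}) (T : SubproductSystem.{v}) where
  toEquiv : ∀ t, S.E t ≃ₗ[ℂ] T.E t
  map_β : ∀ (s t : ℕ+) (x : S.E (s + t)),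
    T.β s t (toEquiv (s + t) x) =
      TensorProduct.map (toEquiv s).toLinearMap (toEquiv t).toLinearMap (S.β s t x)

/-- The vector `e₁ = (1, 0)`. -/
def stdE₁ : ℂ × ℂ := (1, 0)

/-- The vector `e₂ = (0, 1)`. -/
def stdE₂ : ℂ × ℂ := (0, 1)

/-- The value `β_{s,t}(e₁)`; it depends on `s` only. -/
noncomputable def stdβ₁ : StdLabel → ℕ+ → (ℂ × ℂ) ⊗[ℂ] (ℂ × ℂ)
  | .one, _ => stdE₁ ⊗ₜ stdE₁
  | .two, s => if Even (s : ℕ) then stdE₁ ⊗ₜ stdE₁ else stdE₁ ⊗ₜ stdE₂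
  | .three _, _ => stdE₁ ⊗ₜ stdE₁
  | .four, _ => stdE₁ ⊗ₜ stdE₁
  | .five, _ => stdE₁ ⊗ₜ stdE₁

/-- The value `β_{s,t}(e₂)`; it depends on `s` only. -/
noncomputable def stdβ₂ : StdLabel → ℕ+ → (ℂ × ℂ) ⊗[ℂ] (ℂ × ℂ)
  | .one, _ => stdE₂ ⊗ₜ stdE₂
  | .two, s => if Even (s : ℕ) then stdE₂ ⊗ₜ stdE₂ else stdE₂ ⊗ₜ stdE₁
  | .three l, s => stdE₂ ⊗ₜ stdE₁ + ((l : ℂ) ^ (s : ℕ)) • (stdE₁ ⊗ₜ stdE₂)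
  | .four, _ => stdE₂ ⊗ₜ stdE₁
  | .five, _ => stdE₁ ⊗ₜ stdE₂

/-- The linear map on `ℂ²` that takes `e₁` to `stdβ₁ i s` and `e₂` to `stdβ₂ i s`. -/
noncomputable def stdβ (i : StdLabel) (s : ℕ+) : ℂ × ℂ →ₗ[ℂ] (ℂ × ℂ) ⊗[ℂ] (ℂ × ℂ) :=
  (LinearMap.fst ℂ ℂ ℂ).smulRight (stdβ₁ i s) + (LinearMap.snd ℂ ℂ ℂ).smulRight (stdβ₂ i s)

theorem stdβ_apply (i : StdLabel) (s : ℕ+) (x : ℂ × ℂ) :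
    stdβ i s x = x.1 • stdβ₁ i s + x.2 • stdβ₂ i s := rfl

theorem stdβ_e₁ (i : StdLabel) (s : ℕ+) : stdβ i s stdE₁ = stdβ₁ i s := by
  simp [stdβ_apply, stdE₁]

theorem stdβ_e₂ (i : StdLabel) (s : ℕ+) : stdβ i s stdE₂ = stdβ₂ i s := by
  simp [stdβ_apply, stdE₂]

theorem stdβ_injective (i : StdLabel) (s : ℕ+) : Function.Injective (stdβ i s) := by
  rw [injective_iff_map_eq_zero]
  intro x hx
  have key : ∀ p q : ℂ × ℂ →ₗ[ℂ] ℂ,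
      LinearMap.mul' ℂ ℂ (TensorProduct.map p q (stdβ i s x)) = 0 := by
    intro p q; rw [hx]; simp
  have h11 := key (LinearMap.fst ℂ ℂ ℂ) (LinearMap.fst ℂ ℂ ℂ)
  have h12 := key (LinearMap.fst ℂ ℂ ℂ) (LinearMap.snd ℂ ℂ ℂ)
  have h21 := key (LinearMap.snd ℂ ℂ ℂ) (LinearMap.fst ℂ ℂ ℂ)
  have h22 := key (LinearMap.snd ℂ ℂ ℂ) (LinearMap.snd ℂ ℂ ℂ)
  clear key hx
  cases i <;> by_cases hs : Even (s : ℕ) <;>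
    simp [stdβ_apply, stdβ₁, stdβ₂, stdE₁, stdE₂, hs] at h11 h12 h21 h22 <;>
    ext <;> simp_all

theorem stdβ_assoc (i : StdLabel) (r s : ℕ+) (x : ℂ × ℂ) :
    TensorProduct.assoc ℂ (ℂ × ℂ) (ℂ × ℂ) (ℂ × ℂ)
        ((stdβ i r).rTensor (ℂ × ℂ) (stdβ i (r + s) x)) =
      (stdβ i s).lTensor (ℂ × ℂ) (stdβ i r x) := by
  cases i
  case two =>
    by_cases hr : Even (r : ℕ) <;> by_cases hs : Even (s : ℕ) <;>
      simp [stdβ_apply _ _ x, stdβ₁, stdβ₂, stdβ_e₁, stdβ_e₂, Nat.even_add, hr, hs]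
  case three l =>
    simp [stdβ_apply _ _ x, stdβ₁, stdβ₂, stdβ_e₁, stdβ_e₂, TensorProduct.add_tmul,
      TensorProduct.tmul_add, ← TensorProduct.smul_tmul', pow_add, smul_smul, smul_add,
      add_assoc, mul_assoc]
  all_goals
    simp [stdβ_apply _ _ x, stdβ₁, stdβ₂, stdβ_e₁, stdβ_e₂]

/-- The standard subproduct systems: `E_t = ℂ²` for all `t`, with `β_{s,t} = stdβ i s`. -/
noncomputable def stdSubproductSystem (i : StdLabel) : SubproductSystem.{0} where
  E := fun _ => ℂ × ℂ
  finrank_eq_two := fun _ => by simp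
  β := fun s _ => stdβ i s
  injective := fun s _ => stdβ_injective i s
  assoc := fun r s _ x => stdβ_assoc i r s x

/-! In coordinates, the positive part of such a graded algebra is an associative family of products
on `ℂ²` whose values span. A subproduct system is the transpose of one: coassociativity becomes
associativity, and injectivity becomes spanning. Both classifications thus reduce to
`exists_equivalent_std` and `eq_of_equivalent_std`.

Existence. Write $L_t(a)$ for left multiplication by $a\in A_1$ on $A_t$. For each $t$, $\det
L_t(e_1+ze_2)$ is a polynomial in $z$ of degree at most two. If none of these vanishes identically,
only countably many $z$ are bad, so some $u=e_1+ze_2$ acts invertibly in all degrees. Identifying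
$A_{t+1}$ with $A_t$ through $u$ makes $u$ a left unit, and associativity then expresses every
product through the operators $L_t(e_2)$. Replacing $e_2$ by $e_2-zu$ with $z$ an eigenvalue of
$L_1(e_2)$ makes $L_1=L_1(e_2)$ singular. The relations $L_{t+1}=\alpha_1+\beta_1L_t$ and
$L_2L_1=\gamma_1+\delta_1L_1$, where $L_1e_1=(\alpha_1,\beta_1)$ and $L_1e_2=(\gamma_1,\delta_1)$,
leave only types 1, 2, 3 and 5.

If one polynomial vanishes identically, spanning yields a nonzero vector killed by all of $A_1$ from
the left. This cannot happen on both sides (`not_both_annihilated`), so the opposite family is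
covered by the first case; type 4 arises as the opposite of type 5.

Uniqueness. Square-zero elements in degrees one and two separate types 1 and 2 from each other and
from the rest. The remaining types differ by the ratio $p:q$ in $p\,ak=q\,ka$ for all $a\in A_1$,
with some $k\ne0$ in $A_1$. -/

/-- A family of products `ℂ² × ℂ² → ℂ²`, indexed by pairs of positive degrees. -/
abbrev ProductFamily : Type := ℕ+ → ℕ+ → ℂ × ℂ →ₗ[ℂ] ℂ × ℂ →ₗ[ℂ] ℂ × ℂ

/-- The standard bilinear pairing on `ℂ²`. -/
noncomputable def pairing : ℂ × ℂ →ₗ[ℂ] ℂ × ℂ →ₗ[ℂ] ℂ :=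
  LinearMap.mk₂ ℂ (fun a x => a.1 * x.1 + a.2 * x.2)
    (fun _ _ _ => by simp; ring) (fun _ _ _ => by simp; ring)
    (fun _ _ _ => by simp; ring) (fun _ _ _ => by simp; ring)

@[simp] theorem pairing_apply (a x : ℂ × ℂ) : pairing a x = a.1 * x.1 + a.2 * x.2 := rfl

theorem pairing_comm (a x : ℂ × ℂ) : pairing a x = pairing x a := by simp [mul_comm]

theorem eq_of_pairing {a b : ℂ × ℂ} (h : ∀ x, pairing a x = pairing b x) : a = b := by
  have h1 := h (1, 0)
  have h2 := h (0, 1)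
  simp at h1 h2
  exact Prod.ext h1 h2

/-! ### Families of products, their opposites, and the standard families -/

namespace ProductFamily

/-- An associative family of products whose ranges span. -/
structure IsTwoDim (m : ProductFamily) : Prop where
  assoc : ∀ r s t a b c, m (r + s) t (m r s a b) c = m r (s + t) a (m s t b c)
  nondegenerate : ∀ s t x, (∀ a b, pairing (m s t a b) x = 0) → x = 0

/-- Isomorphism of families of products. -/
def Equivalent (m m' : ProductFamily) : Prop :=
  ∃ θ : ℕ+ → (ℂ × ℂ) ≃ₗ[ℂ] ℂ × ℂ, ∀ s t a b, θ (s + t) (m s t a b) = m' s t (θ s a) (θ t b)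

theorem Equivalent.trans {m₁ m₂ m₃ : ProductFamily} (h : Equivalent m₁ m₂)
    (h' : Equivalent m₂ m₃) : Equivalent m₁ m₃ := by
  obtain ⟨θ, hθ⟩ := h
  obtain ⟨φ, hφ⟩ := h'
  exact ⟨fun t => (θ t).trans (φ t), fun s t a b => by simp [hθ, hφ]⟩

/-- The family of products carried over by invertible linear maps. -/
def transport (m : ProductFamily) (θ : ℕ+ → (ℂ × ℂ) ≃ₗ[ℂ] ℂ × ℂ) : ProductFamily := fun s t =>
  ((m s t).compl₁₂ (θ s).symm.toLinearMap (θ t).symm.toLinearMap).compr₂ (θ (s + t)).toLinearMap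

theorem transport_apply (m : ProductFamily) (θ : ℕ+ → (ℂ × ℂ) ≃ₗ[ℂ] ℂ × ℂ) (s t : ℕ+)
    (a b : ℂ × ℂ) :
    m.transport θ s t a b = θ (s + t) (m s t ((θ s).symm a) ((θ t).symm b)) := rfl

theorem equivalent_transport (m : ProductFamily) (θ : ℕ+ → (ℂ × ℂ) ≃ₗ[ℂ] ℂ × ℂ) :
    Equivalent m (m.transport θ) :=
  ⟨θ, fun s t a b => by simp [transport_apply]⟩

theorem transport_assoc {m : ProductFamily}
    (hm : ∀ r s t a b c, m (r + s) t (m r s a b) c = m r (s + t) a (m s t b c))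
    (θ : ℕ+ → (ℂ × ℂ) ≃ₗ[ℂ] ℂ × ℂ) (r s t : ℕ+) (a b c : ℂ × ℂ) :
    m.transport θ (r + s) t (m.transport θ r s a b) c =
      m.transport θ r (s + t) a (m.transport θ s t b c) := by
  simp [transport_apply, hm, add_assoc]

/-- The opposite family of products. -/
def op (m : ProductFamily) : ProductFamily := fun s t => (m t s).flip

theorem op_apply (m : ProductFamily) (s t : ℕ+) (a b : ℂ × ℂ) : m.op s t a b = m t s b a := rfl

theorem IsTwoDim.op {m : ProductFamily} (hm : m.IsTwoDim) : m.op.IsTwoDim where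
  assoc r s t a b c := by
    simp only [op_apply, add_comm r s, add_comm s t, hm.assoc]
  nondegenerate s t x h := hm.nondegenerate t s x fun a b => h b a

theorem Equivalent.op {m m' : ProductFamily} (h : Equivalent m m') :
    Equivalent m.op m'.op := by
  obtain ⟨θ, hθ⟩ := h
  exact ⟨θ, fun s t a b => by rw [op_apply, op_apply, add_comm, hθ]⟩

/-- The standard families of products. -/
noncomputable def std (i : StdLabel) : ProductFamily := fun s _ =>
  LinearMap.mk₂ ℂ (stdMul i s) (stdMul_add_left i s) (stdMul_smul_left i s)
    (stdMul_add_right i s) (stdMul_smul_right i s)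

@[simp] theorem std_apply (i : StdLabel) (s t : ℕ+) (a b : ℂ × ℂ) :
    std i s t a b = stdMul i s a b := rfl

/-- The invertible linear map `(a₁, a₂) ↦ (a₁, p a₁ + q a₂)`. -/
noncomputable def shear (p q : ℂ) (hq : q ≠ 0) : (ℂ × ℂ) ≃ₗ[ℂ] ℂ × ℂ where
  toFun a := (a.1, p * a.1 + q * a.2)
  invFun a := (a.1, q⁻¹ * (a.2 - p * a.1))
  map_add' a b := by ext <;> simp; ring
  map_smul' c a := by ext <;> simp; ring
  left_inv a := by ext <;> simp [hq]
  right_inv a := by ext <;> simp [hq]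

@[simp] theorem shear_apply (p q : ℂ) (hq : q ≠ 0) (a : ℂ × ℂ) :
    shear p q hq a = (a.1, p * a.1 + q * a.2) := rfl

@[simp] theorem shear_symm_apply (p q : ℂ) (hq : q ≠ 0) (a : ℂ × ℂ) :
    (shear p q hq).symm a = (a.1, q⁻¹ * (a.2 - p * a.1)) := rfl

/-- The label of the opposite of a standard family. -/
noncomputable def opLabel : StdLabel → StdLabel
  | .one => .one
  | .two => .two
  | .three l => .three l⁻¹
  | .four => .five
  | .five => .four

/-- For type 2 the coordinates are swapped in odd degrees; for type 3 the second coordinate is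
scaled by $\lambda^{-t}$ in degree $t$. The other types need no change of coordinates. -/
theorem equivalent_std_op (i : StdLabel) : Equivalent (std i).op (std (opLabel i)) := by
  cases i with
  | one => exact ⟨fun _ => LinearEquiv.refl ℂ _, fun s t a b => by
      simp [op_apply, opLabel, stdMul, mul_comm]⟩
  | two =>
    refine ⟨fun t => if Even (t : ℕ) then LinearEquiv.refl ℂ _ else LinearEquiv.prodComm ℂ ℂ ℂ,
      fun s t a b => ?_⟩
    by_cases hs : Even (s : ℕ) <;> by_cases ht : Even (t : ℕ) <;>
      simp [op_apply, opLabel, stdMul, hs, ht, Nat.even_add, mul_comm]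
  | three l =>
    have hl : ∀ t : ℕ+, ((l : ℂ)⁻¹) ^ (t : ℕ) ≠ 0 := fun t => by simp
    refine ⟨fun t => shear 0 _ (hl t), fun s t a b => ?_⟩
    have := hl s
    have := hl t
    simp [op_apply, opLabel, stdMul, pow_add]
    field_simp
    ring_nf
    simp
  | four => exact ⟨fun _ => LinearEquiv.refl ℂ _, fun s t a b => by
      simp [op_apply, opLabel, stdMul, mul_comm]⟩
  | five => exact ⟨fun _ => LinearEquiv.refl ℂ _, fun s t a b => by
      simp [op_apply, opLabel, stdMul, mul_comm]⟩

/-! ### The standard families are pairwise inequivalent -/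

theorem Equivalent.square_zero {m m' : ProductFamily} (h : Equivalent m m') (t : ℕ+)
    (H : ∀ a, m' t t a a = 0 → a = 0) (a : ℂ × ℂ) (ha : m t t a a = 0) : a = 0 := by
  obtain ⟨θ, hθ⟩ := h
  exact (θ t).map_eq_zero_iff.1 (H _ (by rw [← hθ, ha, map_zero]))

theorem Equivalent.twisted_commute {m m' : ProductFamily} (h : Equivalent m m') {p q : ℂ}
    (H : ∃ k ≠ 0, ∀ a, p • m 1 1 a k = q • m 1 1 k a) :
    ∃ k ≠ 0, ∀ a, p • m' 1 1 a k = q • m' 1 1 k a := by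
  obtain ⟨θ, hθ⟩ := h
  obtain ⟨k, hk, H⟩ := H
  refine ⟨θ 1 k, by simpa using hk, fun a => ?_⟩
  have := congrArg (θ (1 + 1)) (H ((θ 1).symm a))
  simpa [hθ] using this

theorem Equivalent.symm {m m' : ProductFamily} (h : Equivalent m m') : Equivalent m' m := by
  obtain ⟨θ, hθ⟩ := h
  refine ⟨fun t => (θ t).symm, fun s t a b => ?_⟩
  rw [LinearEquiv.symm_apply_eq, hθ]
  simp

theorem std_one_square_zero (t : ℕ+) (a : ℂ × ℂ) (h : std .one t t a a = 0) : a = 0 := by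
  simpa [stdMul, Prod.ext_iff] using h

theorem std_two_square_zero (a : ℂ × ℂ) (h : std .two 2 2 a a = 0) : a = 0 := by
  have : Even ((2 : ℕ+) : ℕ) := ⟨1, rfl⟩
  simpa [stdMul, Prod.ext_iff, this] using h

theorem not_equivalent_of_square_zero {m m' : ProductFamily} (t : ℕ+)
    (H : ∀ a, m' t t a a = 0 → a = 0) {k : ℂ × ℂ} (hk : k ≠ 0) (h : m t t k k = 0) :
    ¬ Equivalent m m' := fun e => hk (e.square_zero t H k h)

/-- Coefficients `(p, q)` for which `p a e₂ = q e₂ a` for all `a` of degree one. -/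
def twist : StdLabel → ℂ × ℂ
  | .one => (0, 0)
  | .two => (0, 0)
  | .three l => (1, l)
  | .four => (1, 0)
  | .five => (0, 1)

theorem std_twisted_commute (i : StdLabel) :
    ∃ k ≠ 0, ∀ a, (twist i).1 • std i 1 1 a k = (twist i).2 • std i 1 1 k a := by
  refine ⟨(0, 1), by simp, fun a => ?_⟩
  cases i <;> simp [twist, stdMul, Prod.ext_iff]

/-- Type 1 has no nonzero square-zero element in degree one, and type 2 has none in degree two but
has one in degree one. In types 3, 4 and 5, $e_2$ squares to zero in every degree; these are
separated by carrying the twisted commutation of $e_2$ over to the other family. -/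
theorem eq_of_equivalent_std {i j : StdLabel} (h : Equivalent (std i) (std j)) : i = j := by
  have key1 : ∀ i : StdLabel, i ≠ .one → ¬ Equivalent (std i) (std .one) := by
    intro i hi
    cases i
    · exact absurd rfl hi
    · exact not_equivalent_of_square_zero 1 (std_one_square_zero 1) (k := (1, 0)) (by simp)
        (by simp [stdMul])
    all_goals
      exact not_equivalent_of_square_zero 1 (std_one_square_zero 1) (k := (0, 1)) (by simp)
        (by simp [stdMul])
  have key2 : ∀ i : StdLabel, i ≠ .one → i ≠ .two → ¬ Equivalent (std i) (std .two) := by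
    intro i hi hi'
    cases i
    · exact absurd rfl hi
    · exact absurd rfl hi'
    all_goals
      exact not_equivalent_of_square_zero 2 std_two_square_zero (k := (0, 1)) (by simp)
        (by simp [stdMul])
  have T := h.twisted_commute (std_twisted_commute i)
  obtain ⟨⟨k₁, k₂⟩, hk, T⟩ := T
  have T1 := Prod.ext_iff.1 (T (1, 0))
  have T2 := Prod.ext_iff.1 (T (0, 1))
  clear T
  by_cases hi1 : i = .one
  · by_contra hne
    exact key1 j (fun hj => hne (hi1.trans hj.symm)) (hi1 ▸ h.symm)
  by_cases hj1 : j = .one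
  · exact absurd (hj1 ▸ h) (key1 i hi1)
  by_cases hi2 : i = .two
  · by_contra hne
    exact key2 j hj1 (fun hj => hne (hi2.trans hj.symm)) (hi2 ▸ h.symm)
  by_cases hj2 : j = .two
  · exact absurd (hj2 ▸ h) (key2 i hi1 hi2)
  cases i <;> cases j <;> simp [twist, stdMul] at T1 T2 hk hi1 hi2 hj1 hj2 ⊢
  case three.three l l' =>
    apply Units.ext
    -- The transported $k$ need not be a multiple of $e_2$. If $k_1\ne0$, comparing first
    -- coordinates at $a=e_1$ gives $\lambda=1$, and then $a=e_2$ gives $\lambda'=1$.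
    by_cases h1 : k₁ = 0
    · have h2 := hk h1
      exact (T1.2.resolve_right h2).symm
    · have h3 : (l : ℂ) = 1 := by simpa [h1] using T1.1
      have h4 := T2
      rw [h3] at h4 ⊢
      have := mul_right_cancel₀ h1 (show 1 * k₁ = l' * k₁ by linear_combination h4)
      exact this
  all_goals grind

end ProductFamily

namespace ProductFamily

/-! ### Families with a left unit in degree one -/

/-- With $u=(1,0)$, an element of degree $s+1$ with coordinates $a$ is $u$ times the element of
degree $s$ with the same coordinates, and $(ua)b=u(ab)$ has the coordinates of $ab$. -/
theorem apply_eq_unit {m : ProductFamily}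
    (hm : ∀ r s t a b c, m (r + s) t (m r s a b) c = m r (s + t) a (m s t b c))
    (hu : ∀ t b, m 1 t (1, 0) b = b) (s t : ℕ+) (a b : ℂ × ℂ) : m s t a b = m 1 t a b := by
  induction s using PNat.recOn generalizing a with
  | one => rfl
  | succ s ih =>
    have h := hm 1 s t (1, 0) a b
    rw [hu, hu, add_comm] at h
    rw [h, ih]

/-- A product for which `(1, 0)` is a left unit, in terms of left multiplication by `(0, 1)`. -/
theorem apply_eq_of_unit {m : ProductFamily} (hu : ∀ t b, m 1 t (1, 0) b = b) (t : ℕ+)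
    (a b : ℂ × ℂ) :
    m 1 t a b = a.1 • b + a.2 • (b.1 • m 1 t (0, 1) (1, 0) + b.2 • m 1 t (0, 1) (0, 1)) := by
  have ha : a = a.1 • ((1, 0) : ℂ × ℂ) + a.2 • ((0, 1) : ℂ × ℂ) := by ext <;> simp
  have hb : b = b.1 • ((1, 0) : ℂ × ℂ) + b.2 • ((0, 1) : ℂ × ℂ) := by ext <;> simp
  conv_lhs => rw [ha]
  simp only [map_add, map_smul, LinearMap.add_apply, LinearMap.smul_apply, hu]
  congr 2
  conv_lhs => rw [hb]
  simp only [map_add, map_smul]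

/-- This is $e_2(wb)=(e_2w)b$ for $w$ of degree one, where the degree-two factor $e_2w$ may be read
in degree one. It gives all the recurrences for left multiplication by $e_2$. -/
theorem left_mul_succ {m : ProductFamily}
    (hm : ∀ r s t a b c, m (r + s) t (m r s a b) c = m r (s + t) a (m s t b c))
    (hu : ∀ t b, m 1 t (1, 0) b = b) (t : ℕ+) (w b : ℂ × ℂ) :
    m 1 (t + 1) (0, 1) (m 1 t w b) = m 1 t (m 1 1 (0, 1) w) b := by
  rw [add_comm t 1, ← hm, apply_eq_unit hm hu]

/-- If `(1, 0)` is a left unit, left multiplication by `(0, 1)` may be assumed singular. -/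
theorem exists_equivalent_singular {m : ProductFamily}
    (hm : ∀ r s t a b c, m (r + s) t (m r s a b) c = m r (s + t) a (m s t b c))
    (hu : ∀ t b, m 1 t (1, 0) b = b) :
    ∃ m' : ProductFamily, Equivalent m m' ∧
      (∀ r s t a b c, m' (r + s) t (m' r s a b) c = m' r (s + t) a (m' s t b c)) ∧
      (∀ t b, m' 1 t (1, 0) b = b) ∧
      (m' 1 1 (0, 1) (1, 0)).1 * (m' 1 1 (0, 1) (0, 1)).2 -
        (m' 1 1 (0, 1) (1, 0)).2 * (m' 1 1 (0, 1) (0, 1)).1 = 0 := by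
  obtain ⟨z, hz⟩ : ∃ z : ℂ, ((m 1 1 (0, 1) (1, 0)).1 - z) * ((m 1 1 (0, 1) (0, 1)).2 - z) -
      (m 1 1 (0, 1) (1, 0)).2 * (m 1 1 (0, 1) (0, 1)).1 = 0 := by
    -- $z$ is an eigenvalue of left multiplication by $e_2$ on degree one; $s$ is a square root of
    -- the discriminant of its characteristic polynomial.
    obtain ⟨s, hs⟩ := IsAlgClosed.exists_pow_nat_eq
      (((m 1 1 (0, 1) (1, 0)).1 - (m 1 1 (0, 1) (0, 1)).2) ^ 2 +
        4 * ((m 1 1 (0, 1) (1, 0)).2 * (m 1 1 (0, 1) (0, 1)).1)) (n := 2) (by norm_num)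
    refine ⟨((m 1 1 (0, 1) (1, 0)).1 + (m 1 1 (0, 1) (0, 1)).2 + s) / 2, ?_⟩
    linear_combination hs / 4
  -- the new basis of `ℂ²` is `(1, 0)`, `(-z, 1)`
  let φ : (ℂ × ℂ) ≃ₗ[ℂ] ℂ × ℂ :=
    (LinearEquiv.prodComm ℂ ℂ ℂ).trans ((shear z 1 one_ne_zero).trans
      (LinearEquiv.prodComm ℂ ℂ ℂ))
  have hφ : ∀ a, φ a = (z * a.2 + a.1, a.2) := fun a => by simp [φ]
  have hφs : ∀ a, φ.symm a = (a.1 - z * a.2, a.2) := fun a => by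
    rw [LinearEquiv.symm_apply_eq, hφ]; simp
  have hT : ∀ a b, m.transport (fun _ => φ) 1 1 a b = φ (m 1 1 (φ.symm a) (φ.symm b)) :=
    fun a b => rfl
  refine ⟨m.transport fun _ => φ, m.equivalent_transport _, transport_assoc hm _, ?_, ?_⟩
  · intro t b
    simp only [transport_apply, hφs]
    simp only [mul_zero, sub_zero, hu]
    rw [hφ]; simp
  · have e₁ := apply_eq_of_unit hu 1 (-z, 1) (1, 0)
    have e₂ := apply_eq_of_unit hu 1 (-z, 1) (-z, 1)
    simp only [hT, hφ, hφs, mul_one, mul_zero, zero_sub, sub_zero, e₁, e₂]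
    simp
    linear_combination hz

/-- An associative product with the left unit `(1, 0)` is of one of the standard forms. -/
theorem exists_equivalent_std_of_unit {m : ProductFamily}
    (hm : ∀ r s t a b c, m (r + s) t (m r s a b) c = m r (s + t) a (m s t b c))
    (hu : ∀ t b, m 1 t (1, 0) b = b) : ∃ i, Equivalent m (std i) := by
  obtain ⟨m', he, hm', hu', hdet⟩ := exists_equivalent_singular hm hu
  suffices h : ∃ i, Equivalent m' (std i) from h.imp fun _ h => he.trans h
  clear hu hm he m
  rename' m' => m, hm' => hm, hu' => hu
  have hM := apply_eq_unit hm hu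
  have hF := apply_eq_of_unit hu
  -- the matrix entries of left multiplication by `(0, 1)`
  set α := fun t => (m 1 t (0, 1) (1, 0)).1 with hα
  set β := fun t => (m 1 t (0, 1) (1, 0)).2 with hβ
  set γ := fun t => (m 1 t (0, 1) (0, 1)).1 with hγ
  set δ := fun t => (m 1 t (0, 1) (0, 1)).2 with hδ
  have hmul : ∀ s t a b, m s t a b = (a.1 * b.1 + a.2 * (b.1 * α t + b.2 * γ t),
      a.1 * b.2 + a.2 * (b.1 * β t + b.2 * δ t)) := by
    intro s t a b
    rw [hM, hF]; rfl
  clear_value α β γ δ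
  -- `h1` and `h2` are the two columns of $L_{t+1}=\alpha_1+\beta_1L_t$; `h3` and `h4` are those of
  -- $L_2L_1=\gamma_1+\delta_1L_1$.
  have h1 := fun t => left_mul_succ hm hu t (1, 0) (1, 0)
  have h2 := fun t => left_mul_succ hm hu t (1, 0) (0, 1)
  have h3 := left_mul_succ hm hu 1 (0, 1) (1, 0)
  have h4 := left_mul_succ hm hu 1 (0, 1) (0, 1)
  simp only [hmul] at h1 h2 h3 h4 hdet
  simp only [Prod.mk.injEq, mul_zero, zero_mul, mul_one, one_mul, zero_add, add_zero]
    at h1 h2 h3 h4 hdet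
  obtain ⟨h11a, h11b⟩ := h1 1
  obtain ⟨h21a, h21b⟩ := h2 1
  rw [h11a, h21a, h11b, h21b] at h3 h4
  obtain ⟨h3a, h3b⟩ := h3
  obtain ⟨h4a, h4b⟩ := h4
  -- Together the relations give $(\alpha_1+\beta_1L_1)L_1=\gamma_1+\delta_1L_1$. On a kernel vector
  -- of the singular $L_1$ this forces $\gamma_1=0$, so also $\alpha_1\delta_1=0$.
  have hγ1 : γ 1 = 0 := by grind
  have hγt : ∀ t, γ t = 0 := by
    intro t
    induction t using PNat.recOn with
    | one => exact hγ1
    | succ t ih => rw [(h2 t).1, ih, mul_zero]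
  rcases eq_or_ne (β 1) 0 with hβ0 | hβ0
  · have hα1 : α 1 = 0 := by grind
    have hδ1 : δ 1 = 0 := by grind
    have ht : ∀ t, α t = 0 ∧ β t = 0 ∧ δ t = 0 := by
      intro t
      induction t using PNat.recOn with
      | one => exact ⟨hα1, hβ0, hδ1⟩
      | succ t ih => rw [(h1 t).1, (h1 t).2, (h2 t).2, hα1, hβ0]; simp
    exact ⟨.five, fun _ => LinearEquiv.refl ℂ _, fun s t a b => by
      simp [hmul, ht, hγt, stdMul]⟩
  rcases eq_or_ne (α 1) 0 with hα1 | hα1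
  · have hαt : ∀ t, α t = 0 := by
      intro t
      induction t using PNat.recOn with
      | one => exact hα1
      | succ t ih => rw [(h1 t).1, ih, hα1, mul_zero, add_zero]
    rcases eq_or_ne (δ 1) 0 with hδ1 | hδ1
    · have hδt : ∀ t, δ t = 0 := by
        intro t
        induction t using PNat.recOn with
        | one => exact hδ1
        | succ t ih => rw [(h2 t).2, ih, hα1, mul_zero, add_zero]
      have hβt : ∀ t, β t = β 1 ^ (t : ℕ) := by
        intro t
        induction t using PNat.recOn with
        | one => simp
        | succ t ih => rw [(h1 t).2, ih, PNat.add_coe, PNat.one_coe, pow_succ, mul_comm]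
      have hq : ∀ t : ℕ+, ((β 1)⁻¹) ^ (t : ℕ) ≠ 0 := fun t => pow_ne_zero _ (inv_ne_zero hβ0)
      refine ⟨.three (Units.mk0 (β 1) hβ0)⁻¹, fun t => shear 0 _ (hq t), fun s t a b => ?_⟩
      simp only [hmul, hαt, hγt, hδt, hβt t, std_apply, stdMul, shear_apply, PNat.add_coe,
        pow_add, Units.val_inv_eq_inv_val, Units.val_mk0]
      ext
      · simp
      · simp
        field_simp
        ring
    · have hβ1 : β 1 = 1 := by grind
      have ht : ∀ t, β t = 1 ∧ δ t = δ 1 := by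
        intro t
        induction t using PNat.recOn with
        | one => exact ⟨hβ1, rfl⟩
        | succ t ih => rw [(h1 t).2, (h2 t).2, ih.1, ih.2, hβ1, hα1]; simp
      refine ⟨.one, fun t => shear 1 _ hδ1, fun s t a b => ?_⟩
      simp only [hmul, hαt, hγt, (ht _).1, (ht _).2, std_apply, stdMul, shear_apply]
      ext
      · simp
      · simp
        ring
  · have hδ1 : δ 1 = 0 := by grind
    have hβ1 : β 1 = -1 := by grind
    have ht : ∀ t : ℕ+, (Even (t : ℕ) → α t = 0 ∧ β t = 1 ∧ δ t = α 1) ∧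
        (¬ Even (t : ℕ) → α t = α 1 ∧ β t = -1 ∧ δ t = 0) := by
      intro t
      induction t using PNat.recOn with
      | one => exact ⟨fun h => absurd h (by simp), fun _ => ⟨rfl, hβ1, hδ1⟩⟩
      | succ t ih =>
        rw [(h1 t).1, (h1 t).2, (h2 t).2, hβ1, PNat.add_coe, PNat.one_coe, Nat.even_add_one]
        constructor
        · intro h
          obtain ⟨e1, e2, e3⟩ := ih.2 h
          simp [e1, e2, e3]
        · intro h
          obtain ⟨e1, e2, e3⟩ := ih.1 (not_not.1 h)
          simp [e1, e2, e3]
    refine ⟨.two, fun t => if Even (t : ℕ) then shear 1 _ hα1 else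
      (shear 1 _ hα1).trans (LinearEquiv.prodComm ℂ ℂ ℂ), fun s t a b => ?_⟩
    by_cases hs : Even (s : ℕ) <;> by_cases h : Even (t : ℕ)
    all_goals
      have h' := ht t
      simp only [h, true_imp_iff, false_imp_iff, not_true, not_false_iff, true_and, and_true] at h'
      obtain ⟨e1, e2, e3⟩ := h'
      simp [hmul, hγt, e1, e2, e3, stdMul, hs, h, Nat.even_add]
      ring_nf
      try trivial

end ProductFamily

/-! ### Pencils of endomorphisms of `ℂ²` -/

/-- The determinant of a linear endomorphism of `ℂ²`. -/
def det₂ (l : ℂ × ℂ →ₗ[ℂ] ℂ × ℂ) : ℂ :=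
  (l (1, 0)).1 * (l (0, 1)).2 - (l (1, 0)).2 * (l (0, 1)).1

/-- The polar form of `det₂`. -/
def polar₂ (l l' : ℂ × ℂ →ₗ[ℂ] ℂ × ℂ) : ℂ :=
  (l (1, 0)).1 * (l' (0, 1)).2 + (l' (1, 0)).1 * (l (0, 1)).2 -
    (l (1, 0)).2 * (l' (0, 1)).1 - (l' (1, 0)).2 * (l (0, 1)).1

theorem apply_eq_coords {M : Type*} [AddCommGroup M] [Module ℂ M] (l : ℂ × ℂ →ₗ[ℂ] M) (a : ℂ × ℂ) :
    l a = a.1 • l (1, 0) + a.2 • l (0, 1) := by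
  have ha : a = a.1 • ((1, 0) : ℂ × ℂ) + a.2 • ((0, 1) : ℂ × ℂ) := by ext <;> simp
  conv_lhs => rw [ha]
  simp only [map_add, map_smul]

theorem exists_ker_of_det₂ {l : ℂ × ℂ →ₗ[ℂ] ℂ × ℂ} (h : det₂ l = 0) :
    ∃ k ≠ 0, l k = 0 := by
  rw [det₂] at h
  by_cases h1 : l (1, 0) = 0
  · exact ⟨(1, 0), by simp, h1⟩
  by_cases h2 : (l (1, 0)).1 = 0
  · refine ⟨(-(l (0, 1)).2, (l (1, 0)).2), ?_, ?_⟩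
    · intro h'
      exact h1 (Prod.ext h2 (Prod.ext_iff.1 h').2)
    · rw [apply_eq_coords]
      ext
      · simp; linear_combination -h
      · simp; ring
  · refine ⟨(-(l (0, 1)).1, (l (1, 0)).1), ?_, ?_⟩
    · intro h'
      exact h2 (Prod.ext_iff.1 h').2
    · rw [apply_eq_coords]
      ext
      · simp; ring
      · simp; linear_combination h

theorem injective_of_det₂ {l : ℂ × ℂ →ₗ[ℂ] ℂ × ℂ} (h : det₂ l ≠ 0) : Function.Injective l := by
  rw [injective_iff_map_eq_zero]
  intro a ha
  rw [apply_eq_coords, Prod.ext_iff] at ha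
  obtain ⟨h1, h2⟩ := ha
  simp at h1 h2
  rw [det₂] at h
  refine Prod.ext (mul_left_cancel₀ h ?_) (mul_left_cancel₀ h ?_) <;>
    simp only [Prod.fst_zero, Prod.snd_zero, mul_zero]
  · linear_combination (l (0, 1)).2 * h1 - (l (0, 1)).1 * h2
  · linear_combination (l (1, 0)).1 * h2 - (l (1, 0)).2 * h1

theorem det₂_add_smul (l l' : ℂ × ℂ →ₗ[ℂ] ℂ × ℂ) (z : ℂ) :
    det₂ (l + z • l') = det₂ l + polar₂ l l' * z + det₂ l' * z ^ 2 := by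
  simp [det₂, polar₂]; ring

/-- A pencil of singular endomorphisms whose ranges span has a common kernel. -/
theorem exists_common_ker {l l' : ℂ × ℂ →ₗ[ℂ] ℂ × ℂ} (h : det₂ l = 0) (h' : det₂ l' = 0)
    (hp : polar₂ l l' = 0)
    (hs : ∀ x, (∀ b, pairing (l b) x = 0) → (∀ b, pairing (l' b) x = 0) → x = 0) :
    ∃ k ≠ 0, l k = 0 ∧ l' k = 0 := by
  obtain ⟨k, hk, hlk⟩ := exists_ker_of_det₂ h
  refine ⟨k, hk, hlk, ?_⟩
  -- This vector is orthogonal to $l'k$. Since $lk=0$, `hp` gives $l'k\wedge lb=0$, and `h'` gives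
  -- $l'k\wedge l'b=0$; so it is orthogonal to both ranges and must vanish.
  have hx := hs (-(l' k).2, (l' k).1) ?_ ?_
  · have := Prod.ext_iff.1 hx
    simp at this
    exact Prod.ext this.2 this.1
  · intro b
    rw [apply_eq_coords] at hlk
    have h1 := (Prod.ext_iff.1 hlk).1
    have h2 := (Prod.ext_iff.1 hlk).2
    rw [apply_eq_coords l b, apply_eq_coords l' k]
    rw [polar₂] at hp
    simp at h1 h2 ⊢
    linear_combination (k.1 * b.2 - k.2 * b.1) * hp -
      (b.1 * (l' (1, 0)).2 + b.2 * (l' (0, 1)).2) * h1 +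
      (b.1 * (l' (1, 0)).1 + b.2 * (l' (0, 1)).1) * h2
  · intro b
    rw [apply_eq_coords l' b, apply_eq_coords l' k]
    rw [det₂] at h'
    simp
    linear_combination (k.1 * b.2 - k.2 * b.1) * h'

theorem finite_setOf_quadratic_eq_zero {p q r : ℂ} (h : ¬ (p = 0 ∧ q = 0 ∧ r = 0)) :
    {z : ℂ | p + q * z + r * z ^ 2 = 0}.Finite := by
  open Polynomial in
  let f : ℂ[X] := C p + C q * X + C r * X ^ 2
  have hf : f ≠ 0 := by
    intro hf
    refine h ⟨?_, ?_, ?_⟩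
    · simpa [f, Polynomial.coeff_X, Polynomial.coeff_C] using congrArg (Polynomial.coeff · 0) hf
    · simpa [f, Polynomial.coeff_X, Polynomial.coeff_C] using congrArg (Polynomial.coeff · 1) hf
    · simpa [f, Polynomial.coeff_X, Polynomial.coeff_C] using congrArg (Polynomial.coeff · 2) hf
  refine (Polynomial.finite_setOfPred_isRoot hf).subset fun z hz => ?_
  simpa [f, Polynomial.IsRoot] using hz

/-! ### Reduction to a left unit, and the classification of families of products -/

namespace ProductFamily

/-- Either some element of degree one acts invertibly from the left in all degrees, or a nonzero
element of some degree is annihilated by all of degree one. -/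
theorem exists_det₂_ne_zero_or {m : ProductFamily} (hm : m.IsTwoDim) :
    (∃ z : ℂ, ∀ t, det₂ (m 1 t (1, z)) ≠ 0) ∨ ∃ t, ∃ k ≠ 0, ∀ a, m 1 t a k = 0 := by
  by_cases H : ∃ t, det₂ (m 1 t (1, 0)) = 0 ∧ polar₂ (m 1 t (1, 0)) (m 1 t (0, 1)) = 0 ∧
      det₂ (m 1 t (0, 1)) = 0
  · right
    obtain ⟨t, h, hp, h'⟩ := H
    obtain ⟨k, hk, h1, h2⟩ := exists_common_ker h h' hp fun x hx hx' =>
      hm.nondegenerate 1 t x fun a b => by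
        rw [apply_eq_coords (m 1 t) a]
        simp only [LinearMap.add_apply, LinearMap.smul_apply, map_add, map_smul, hx, hx',
          smul_zero, add_zero]
    refine ⟨t, k, hk, fun a => ?_⟩
    rw [apply_eq_coords (m 1 t) a]
    simp [h1, h2]
  · left
    push Not at H
    have hc : (⋃ t, {z : ℂ | det₂ (m 1 t (1, 0)) + polar₂ (m 1 t (1, 0)) (m 1 t (0, 1)) * z +
        det₂ (m 1 t (0, 1)) * z ^ 2 = 0}).Countable :=
      Set.countable_iUnion fun t => (finite_setOf_quadratic_eq_zero fun h =>
        H t h.1 h.2.1 h.2.2).countable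
    obtain ⟨z, hz⟩ := (Set.ne_univ_iff_exists_notMem _).1 fun h =>
      not_countable_complex (h ▸ hc)
    refine ⟨z, fun t ht => hz (Set.mem_iUnion.2 ⟨t, ?_⟩)⟩
    have : ((1, z) : ℂ × ℂ) = (1, 0) + z • (0, 1) := by ext <;> simp
    rw [this, map_add, map_smul, det₂_add_smul] at ht
    exact ht

theorem IsTwoDim.linearMap_eq_zero {m : ProductFamily} (hm : m.IsTwoDim) (s t : ℕ+)
    (f : ℂ × ℂ →ₗ[ℂ] ℂ × ℂ) (h : ∀ a b, f (m s t a b) = 0) : f = 0 := by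
  -- The pair is the transpose of $f$ applied to $x$; it is orthogonal to every product.
  have key : ∀ x, (pairing (f (1, 0)) x, pairing (f (0, 1)) x) = (0 : ℂ × ℂ) := fun x =>
    hm.nondegenerate s t _ fun a b => by
      have := congrArg (pairing · x) ((apply_eq_coords f _).symm.trans (h a b))
      simp at this ⊢
      linear_combination this
  have h1 : f (1, 0) = 0 := eq_of_pairing fun x => by
    simpa using (Prod.ext_iff.1 (key x)).1
  have h2 : f (0, 1) = 0 := eq_of_pairing fun x => by
    simpa using (Prod.ext_iff.1 (key x)).2
  ext1 <;> ext1 <;> simp [h1, h2]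

/-- Degree $s+1$ is spanned by products $bc$ with $c$ of degree one, and $(bc)k=b(ck)=0$. -/
theorem annihilated_of_annihilated_one {m : ProductFamily} (hm : m.IsTwoDim) {t : ℕ+}
    {k : ℂ × ℂ} (h : ∀ a, m 1 t a k = 0) (s : ℕ+) (a : ℂ × ℂ) : m s t a k = 0 := by
  induction s using PNat.recOn with
  | one => exact h a
  | succ s _ =>
    exact LinearMap.congr_fun (hm.linearMap_eq_zero s 1 ((m (s + 1) t).flip k) fun b c => by
      rw [LinearMap.flip_apply, hm.assoc, h, map_zero]) a

theorem exists_complement {k : ℂ × ℂ} (hk : k ≠ 0) :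
    ∃ w : ℂ × ℂ, ∀ a, ∃ p q : ℂ, a = p • k + q • w := by
  by_cases h : k.1 = 0
  · have h2 : k.2 ≠ 0 := fun h2 => hk (Prod.ext h h2)
    refine ⟨(1, 0), fun a => ⟨a.2 / k.2, a.1, ?_⟩⟩
    ext <;> simp [h, h2]
  · refine ⟨(0, 1), fun a => ⟨a.1 / k.1, a.2 - a.1 / k.1 * k.2, ?_⟩⟩
    ext <;> simp [h]

theorem exists_pairing_eq_zero (v : ℂ × ℂ) : ∃ x ≠ 0, pairing v x = 0 := by
  by_cases h : v = 0
  · exact ⟨(1, 0), by simp, by simp [h]⟩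
  · refine ⟨(-v.2, v.1), fun h' => h ?_, by simp; ring⟩
    have := Prod.ext_iff.1 h'
    simp at this
    exact Prod.ext this.2 this.1

/-- The left and the right alternatives cannot fail together. -/
theorem not_both_annihilated {m : ProductFamily} (hm : m.IsTwoDim) {s t : ℕ+} {k k' : ℂ × ℂ}
    (hk : k ≠ 0) (hk' : k' ≠ 0) (h : ∀ a, m s t a k = 0) (h' : ∀ b, m s t k' b = 0) : False := by
  obtain ⟨w, hw⟩ := exists_complement hk
  obtain ⟨w', hw'⟩ := exists_complement hk'
  -- Modulo $k'$ on the left and $k$ on the right, every product is a multiple of $w'w$, so the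
  -- products span at most a line.
  obtain ⟨x, hx, hvx⟩ := exists_pairing_eq_zero (m s t w' w)
  refine hx (hm.nondegenerate s t x fun a b => ?_)
  obtain ⟨p, q, rfl⟩ := hw' a
  obtain ⟨p', q', rfl⟩ := hw b
  simp only [map_add, map_smul, LinearMap.add_apply, LinearMap.smul_apply, h, h', hvx, smul_zero,
    add_zero, zero_add]

/-- With $u=(1,z)$, choose coordinates in degree one that send $u$ to $(1,0)$, and continue to
degree $t+1$ through left multiplication by $u$ on degree $t$. In these coordinates $u$ is a left
unit. -/
theorem exists_equivalent_std_of_det₂ {m : ProductFamily} (hm : m.IsTwoDim) {z : ℂ}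
    (hz : ∀ t, det₂ (m 1 t (1, z)) ≠ 0) : ∃ i, Equivalent m (std i) := by
  let L : ℕ+ → (ℂ × ℂ) ≃ₗ[ℂ] ℂ × ℂ := fun t =>
    LinearEquiv.ofInjectiveEndo (m 1 t (1, z)) (injective_of_det₂ (hz t))
  let θ : ℕ+ → (ℂ × ℂ) ≃ₗ[ℂ] ℂ × ℂ := fun t =>
    PNat.recOn t (shear z 1 one_ne_zero) fun t f => f.trans (L t)
  have hθ1 : θ 1 = shear z 1 one_ne_zero := PNat.recOn_one _ _
  have hθs : ∀ t, θ (t + 1) = (θ t).trans (L t) := fun t => PNat.recOn_succ t _ _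
  obtain ⟨i, hi⟩ := exists_equivalent_std_of_unit
    (m := m.transport fun t => (θ t).symm) (transport_assoc hm.assoc _) fun t b => by
      rw [transport_apply, LinearEquiv.symm_apply_eq, add_comm, hθs, hθ1]
      simp [L]
  exact ⟨i, (m.equivalent_transport _).trans hi⟩

theorem exists_equivalent_std {m : ProductFamily} (hm : m.IsTwoDim) :
    ∃ i, Equivalent m (std i) := by
  rcases exists_det₂_ne_zero_or hm with ⟨z, hz⟩ | ⟨t, k, hk, h⟩
  · exact exists_equivalent_std_of_det₂ hm hz
  rcases exists_det₂_ne_zero_or hm.op with ⟨z, hz⟩ | ⟨s, k', hk', h'⟩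
  · obtain ⟨i, hi⟩ := exists_equivalent_std_of_det₂ hm.op hz
    exact ⟨opLabel i, Equivalent.trans hi.op (equivalent_std_op i)⟩
  · exact (not_both_annihilated hm hk hk' (annihilated_of_annihilated_one hm h s)
      (annihilated_of_annihilated_one hm.op h' t)).elim

end ProductFamily

/-! ### Graded algebras -/

open ProductFamily

theorem GradedMonoid.mk_map_eq {ι : Type*} {A : ι → Type*} {B : ι → Type*} (φ : ∀ n, A n → B n)
    {n k : ι} {x : A n} {y : A k} (h : GradedMonoid.mk n x = GradedMonoid.mk k y) :
    GradedMonoid.mk n (φ n x) = GradedMonoid.mk k (φ k y) :=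
  congrArg (fun z : GradedMonoid A => GradedMonoid.mk z.1 (φ z.1 z.2)) h

theorem GradedMonoid.mk_injective {ι : Type*} {A : ι → Type*} {n : ι} {x y : A n}
    (h : GradedMonoid.mk n x = GradedMonoid.mk n y) : x = y :=
  eq_of_heq (Sigma.mk.inj_iff.1 h).2

namespace GradedAlgebraIso

variable {A : ℕ → Type*} {B : ℕ → Type*} {C : ℕ → Type*}
  [∀ n, AddCommGroup (A n)] [∀ n, Module ℂ (A n)] [DirectSum.GRing A] [DirectSum.GAlgebra ℂ A]
  [∀ n, AddCommGroup (B n)] [∀ n, Module ℂ (B n)] [DirectSum.GRing B] [DirectSum.GAlgebra ℂ B]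
  [∀ n, AddCommGroup (C n)] [∀ n, Module ℂ (C n)] [DirectSum.GRing C] [DirectSum.GAlgebra ℂ C]

def symm (f : GradedAlgebraIso A B) : GradedAlgebraIso B A where
  toEquiv n := (f.toEquiv n).symm
  map_one := by rw [LinearEquiv.symm_apply_eq, f.map_one]
  map_mul s t x y := by rw [LinearEquiv.symm_apply_eq, f.map_mul]; simp

def trans (f : GradedAlgebraIso A B) (g : GradedAlgebraIso B C) : GradedAlgebraIso A C where
  toEquiv n := (f.toEquiv n).trans (g.toEquiv n)
  map_one := by simp [f.map_one, g.map_one]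
  map_mul s t x y := by simp [f.map_mul, g.map_mul]

end GradedAlgebraIso

section

variable {A : ℕ → Type*} [∀ n, AddCommGroup (A n)] [∀ n, Module ℂ (A n)]
  [DirectSum.GRing A] [DirectSum.GAlgebra ℂ A]

variable (A) in
/-- The multiplication of a graded algebra in positive degrees. -/
noncomputable def posMul (s t : ℕ+) : A s →ₗ[ℂ] A t →ₗ[ℂ] A (s + t : ℕ+) :=
  DirectSum.gMulLHom ℂ A

theorem mk_posMul (s t : ℕ+) (a : A s) (b : A t) :
    GradedMonoid.mk (A := A) (s + t : ℕ+) (posMul A s t a b) =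
      GradedMonoid.mk (A := A) s a * GradedMonoid.mk (A := A) t b := rfl

theorem mk_posMul_assoc (r s t : ℕ+) (a : A r) (b : A s) (c : A t) :
    GradedMonoid.mk (A := A) (r + s + t : ℕ+) (posMul A (r + s) t (posMul A r s a b) c) =
      GradedMonoid.mk (A := A) (r + (s + t) : ℕ+) (posMul A r (s + t) a (posMul A s t b c)) := by
  simp only [mk_posMul, mul_assoc]

theorem IsTwoDimGradedAlgebra.posMul_surjective (hA : IsTwoDimGradedAlgebra A) (s t : ℕ+) :
    Function.Surjective (TensorProduct.lift (posMul A s t)) :=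
  hA.mul_surjective s t s.2 t.2

theorem GradedAlgebraIso.map_posMul {B : ℕ → Type*} [∀ n, AddCommGroup (B n)]
    [∀ n, Module ℂ (B n)] [DirectSum.GRing B] [DirectSum.GAlgebra ℂ B]
    (f : GradedAlgebraIso A B) (s t : ℕ+) (a : A s) (b : A t) :
    f.toEquiv (s + t : ℕ+) (posMul A s t a b) =
      posMul B s t (f.toEquiv s a) (f.toEquiv t b) := f.map_mul s t a b

/-- The products of positive degree of a graded algebra in the given coordinates. -/
noncomputable def gradedProductFamily (e : ∀ t : ℕ+, A t ≃ₗ[ℂ] ℂ × ℂ) : ProductFamily :=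
  fun s t => ((posMul A s t).compl₁₂ (e s).symm.toLinearMap
    (e t).symm.toLinearMap).compr₂ (e (s + t)).toLinearMap

theorem gradedProductFamily_apply (e : ∀ t : ℕ+, A t ≃ₗ[ℂ] ℂ × ℂ) (s t : ℕ+) (a b : ℂ × ℂ) :
    gradedProductFamily e s t a b =
      e (s + t) (posMul A s t ((e s).symm a) ((e t).symm b)) := rfl

theorem isTwoDim_gradedProductFamily (hA : IsTwoDimGradedAlgebra A)
    (e : ∀ t : ℕ+, A t ≃ₗ[ℂ] ℂ × ℂ) : (gradedProductFamily e).IsTwoDim where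
  assoc r s t a b c := by
    have key : ∀ {p q : ℕ+} (_ : p = q) {x : A p} {y : A q},
        GradedMonoid.mk (A := A) p x = GradedMonoid.mk (A := A) q y → e p x = e q y := by
      rintro p _ rfl x y h
      rw [GradedMonoid.mk_injective h]
    simp only [gradedProductFamily_apply, LinearEquiv.symm_apply_apply]
    exact key (add_assoc r s t) (mk_posMul_assoc r s t _ _ _)
  nondegenerate s t x h := by
    -- A vector orthogonal to all products is orthogonal to the image of the whole tensor product,
    -- which is everything by surjectivity.
    have key : ∀ z, pairing (e (s + t) (TensorProduct.lift (posMul A s t) z)) x = 0 := by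
      intro z
      induction z with
      | zero => rw [map_zero, map_zero, map_zero, LinearMap.zero_apply]
      | add y z hy hz => rw [map_add, map_add, map_add, LinearMap.add_apply, hy, hz, add_zero]
      | tmul a b =>
        have := h (e s a) (e t b)
        rw [gradedProductFamily_apply, LinearEquiv.symm_apply_apply,
          LinearEquiv.symm_apply_apply] at this
        exact this
    refine eq_of_pairing fun y => ?_
    obtain ⟨z, hz⟩ := hA.posMul_surjective s t ((e (s + t)).symm y)
    have := key z
    rw [hz, LinearEquiv.apply_symm_apply] at this
    rw [pairing_comm, this, map_zero, LinearMap.zero_apply]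

/-- The isomorphism `ℂ → A 0`. -/
noncomputable def zeroEquiv (h : Function.Bijective (DirectSum.GAlgebra.toFun : ℂ →+ A 0)) :
    ℂ ≃ₗ[ℂ] A 0 :=
  LinearEquiv.ofBijective
    { toFun := (DirectSum.GAlgebra.toFun : ℂ →+ A 0)
      map_add' := map_add _
      map_smul' := fun c d => by
        have h := DirectSum.GAlgebra.smul_def c
          (GradedMonoid.mk 0 (DirectSum.GAlgebra.toFun (A := A) d))
        exact GradedMonoid.mk_injective ((DirectSum.GAlgebra.map_mul c d).trans h.symm) } h

end

namespace StdAlg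

/-- The component of positive degree `t` is `ℂ²`. -/
noncomputable def coords (i : StdLabel) : ∀ t : ℕ+, StdAlg i t ≃ₗ[ℂ] ℂ × ℂ
  | ⟨0, h⟩ => absurd h (by simp)
  | ⟨_ + 1, _⟩ => LinearEquiv.refl ℂ (ℂ × ℂ)

theorem coords_mul (i : StdLabel) : ∀ (s t : ℕ+) (a : StdAlg i s) (b : StdAlg i t),
    coords i (s + t) (posMul (StdAlg i) s t a b) = stdMul i s (coords i s a) (coords i t b)
  | ⟨0, h⟩, _, _, _ => absurd h (by simp)
  | ⟨_ + 1, _⟩, ⟨0, h⟩, _, _ => absurd h (by simp)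
  | ⟨_ + 1, _⟩, ⟨_ + 1, _⟩, _, _ => rfl

theorem exists_stdMul_eq (i : StdLabel) (s : ℕ) (z : ℂ × ℂ) :
    ∃ a b : ℂ × ℂ, stdMul i s a b = z := by
  cases i with
  | one => exact ⟨(1, 1), z, by simp [stdMul]⟩
  | two =>
    by_cases h : Even s
    · exact ⟨(1, 1), z, by simp [stdMul, h]⟩
    · exact ⟨(1, 1), (z.2, z.1), by simp [stdMul, h]⟩
  | three l => exact ⟨z, (1, 0), by simp [stdMul]⟩
  | four => exact ⟨z, (1, 0), by simp [stdMul]⟩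
  | five => exact ⟨(1, 0), z, by simp [stdMul]⟩

theorem isTwoDimGradedAlgebra (i : StdLabel) : IsTwoDimGradedAlgebra (StdAlg i) where
  zero_bijective := Function.bijective_id
  finrank_eq_two t ht := (coords i ⟨t, ht⟩).finrank_eq.trans (by simp)
  mul_surjective
    | 0, _, h, _ => absurd h (by simp)
    | _ + 1, 0, _, h => absurd h (by simp)
    | s + 1, t + 1, _, _ => fun y => by
      obtain ⟨a, b, h⟩ := exists_stdMul_eq i (s + 1) y
      exact ⟨(show StdAlg i (s + 1) from a) ⊗ₜ[ℂ] (show StdAlg i (t + 1) from b), h⟩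

theorem eq_of_iso {i j : StdLabel} (f : GradedAlgebraIso (StdAlg i) (StdAlg j)) : i = j := by
  refine eq_of_equivalent_std ⟨fun t => (coords i t).symm.trans
    ((f.toEquiv t).trans (coords j t)), fun s t a b => ?_⟩
  have h : (coords i (s + t)).symm (stdMul i s a b) =
      posMul (StdAlg i) s t ((coords i s).symm a) ((coords i t).symm b) := by
    rw [LinearEquiv.symm_apply_eq, coords_mul, LinearEquiv.apply_symm_apply,
      LinearEquiv.apply_symm_apply]
  simp only [std_apply, LinearEquiv.trans_apply, h, f.map_posMul, coords_mul]

end StdAlg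

/-- The equivalence of product families supplies the positive degrees. Degree zero consists of
scalars, so products with it are preserved by linearity and centrality of scalars. -/
theorem exists_graded_iso {A : ℕ → Type*} [∀ n, AddCommGroup (A n)] [∀ n, Module ℂ (A n)]
    [DirectSum.GRing A] [DirectSum.GAlgebra ℂ A] (hA : IsTwoDimGradedAlgebra A) :
    ∃ i, Nonempty (GradedAlgebraIso A (StdAlg i)) := by
  have he : ∀ t : ℕ+, Nonempty (A t ≃ₗ[ℂ] ℂ × ℂ) := fun t => by
    have h := hA.finrank_eq_two t t.2
    have : Module.Finite ℂ (A t) := Module.finite_of_finrank_pos (by omega)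
    exact ⟨LinearEquiv.ofFinrankEq _ _ (by simp [h])⟩
  let e := fun t => (he t).some
  obtain ⟨i, θ, hθ⟩ := exists_equivalent_std (isTwoDim_gradedProductFamily hA e)
  refine ⟨i, ⟨?_⟩⟩
  let Φ : ∀ n, A n ≃ₗ[ℂ] StdAlg i n := fun n => match n with
    | 0 => (zeroEquiv hA.zero_bijective).symm
    | n + 1 => ((e n.succPNat).trans (θ n.succPNat)).trans
        (StdAlg.coords i n.succPNat).symm
  have hΦ0 : ∀ c, Φ 0 (DirectSum.GAlgebra.toFun c) =
      (DirectSum.GAlgebra.toFun c : StdAlg i 0) := fun c =>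
    (zeroEquiv hA.zero_bijective).symm_apply_apply c
  have hΦ : ∀ (n : ℕ+) (x : A n), StdAlg.coords i n (Φ n x) = θ n (e n x) := by
    intro n x
    obtain ⟨n, rfl⟩ : ∃ k : ℕ, n = k.succPNat := ⟨n.natPred, by simp⟩
    exact LinearEquiv.apply_symm_apply _ _
  have hpos : ∀ (s t : ℕ+) (x : A s) (y : A t),
      Φ (s + t : ℕ+) (posMul A s t x y) = posMul (StdAlg i) s t (Φ s x) (Φ t y) := by
    intro s t x y
    apply (StdAlg.coords i (s + t)).injective
    have h := hθ s t (e s x) (e t y)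
    rw [gradedProductFamily_apply, LinearEquiv.symm_apply_apply,
      LinearEquiv.symm_apply_apply] at h
    rw [hΦ, h, StdAlg.coords_mul, std_apply, ← hΦ, ← hΦ]
  refine ⟨Φ, ?_, ?_⟩
  · have := hΦ0 1
    rw [DirectSum.GAlgebra.map_one, DirectSum.GAlgebra.map_one] at this
    exact this
  · intro s t x y
    rcases Nat.eq_zero_or_pos s with rfl | hs
    · obtain ⟨c, rfl⟩ := hA.zero_bijective.2 x
      rw [hΦ0]
      apply GradedMonoid.mk_injective
      have h1 := GradedMonoid.mk_map_eq (fun n => Φ n)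
        (DirectSum.GAlgebra.smul_def c (GradedMonoid.mk t y))
      have h2 := DirectSum.GAlgebra.smul_def c (GradedMonoid.mk t (Φ t y))
      refine h1.symm.trans (Eq.trans ?_ h2)
      exact congrArg (GradedMonoid.mk t) (map_smul (Φ t) c y)
    rcases Nat.eq_zero_or_pos t with rfl | ht
    · obtain ⟨c, rfl⟩ := hA.zero_bijective.2 y
      rw [hΦ0]
      apply GradedMonoid.mk_injective
      have h1 := GradedMonoid.mk_map_eq (fun n => Φ n)
        ((DirectSum.GAlgebra.smul_def c (GradedMonoid.mk s x)).trans
          (DirectSum.GAlgebra.commutes c (GradedMonoid.mk s x)))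
      have h2 := (DirectSum.GAlgebra.smul_def c (GradedMonoid.mk s (Φ s x))).trans
          (DirectSum.GAlgebra.commutes c (GradedMonoid.mk s (Φ s x)))
      refine h1.symm.trans (Eq.trans ?_ h2)
      exact congrArg (GradedMonoid.mk s) (map_smul (Φ s) c x)
    · exact hpos ⟨s, hs⟩ ⟨t, ht⟩ x y

/-! ### Subproduct systems -/

namespace SubproductSystemIso

def symm {S : SubproductSystem.{u}} {T : SubproductSystem.{v}} (f : SubproductSystemIso S T) :
    SubproductSystemIso T S where
  toEquiv t := (f.toEquiv t).symm
  map_β s t x := by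
    obtain ⟨y, rfl⟩ := (f.toEquiv (s + t)).surjective x
    rw [f.map_β, LinearEquiv.symm_apply_apply, ← LinearMap.comp_apply, ← TensorProduct.map_comp]
    simp

def trans {S : SubproductSystem.{u}} {T : SubproductSystem.{v}} {R : SubproductSystem.{u}}
    (f : SubproductSystemIso S T) (g : SubproductSystemIso T R) : SubproductSystemIso S R where
  toEquiv t := (f.toEquiv t).trans (g.toEquiv t)
  map_β s t x := by
    rw [LinearEquiv.trans_apply, g.map_β, f.map_β, ← LinearMap.comp_apply,
      ← TensorProduct.map_comp]
    rfl

end SubproductSystemIso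

/-! ### Duality between products and coproducts on `ℂ²` -/

/-- The linear functional `x ⊗ y ↦ ⟨a, x⟩ ⟨b, y⟩`. -/
noncomputable def pairing₂ (a b : ℂ × ℂ) : (ℂ × ℂ) ⊗[ℂ] (ℂ × ℂ) →ₗ[ℂ] ℂ :=
  TensorProduct.lift ((LinearMap.mul ℂ ℂ).compl₁₂ (pairing a) (pairing b))

@[simp] theorem pairing₂_tmul (a b x y : ℂ × ℂ) :
    pairing₂ a b (x ⊗ₜ y) = pairing a x * pairing b y := rfl

theorem eq_of_pairing₂ {z z' : (ℂ × ℂ) ⊗[ℂ] (ℂ × ℂ)} (h : ∀ a b, pairing₂ a b z = pairing₂ a b z') :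
    z = z' := by
  have key : ∀ z : (ℂ × ℂ) ⊗[ℂ] (ℂ × ℂ), z =
      pairing₂ (1, 0) (1, 0) z • ((1, 0) : ℂ × ℂ) ⊗ₜ[ℂ] ((1, 0) : ℂ × ℂ) +
      pairing₂ (1, 0) (0, 1) z • ((1, 0) : ℂ × ℂ) ⊗ₜ[ℂ] ((0, 1) : ℂ × ℂ) +
      pairing₂ (0, 1) (1, 0) z • ((0, 1) : ℂ × ℂ) ⊗ₜ[ℂ] ((1, 0) : ℂ × ℂ) +
      pairing₂ (0, 1) (0, 1) z • ((0, 1) : ℂ × ℂ) ⊗ₜ[ℂ] ((0, 1) : ℂ × ℂ) := by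
    intro z
    induction z with
    | zero => simp
    | add x y hx hy =>
      conv_lhs => rw [hx, hy]
      simp only [map_add]
      module
    | tmul x y =>
      have hx : x = x.1 • ((1, 0) : ℂ × ℂ) + x.2 • ((0, 1) : ℂ × ℂ) := by ext <;> simp
      have hy : y = y.1 • ((1, 0) : ℂ × ℂ) + y.2 • ((0, 1) : ℂ × ℂ) := by ext <;> simp
      conv_lhs => rw [hx, hy]
      simp only [TensorProduct.add_tmul, TensorProduct.tmul_add,
        TensorProduct.tmul_smul, pairing₂_tmul, pairing_apply, ← TensorProduct.smul_tmul',
        smul_add, smul_smul, one_mul, zero_mul, add_zero, zero_add]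
      module
  rw [key z, key z']
  simp only [h]

theorem pairing₂_add_left (a a' b : ℂ × ℂ) (z : (ℂ × ℂ) ⊗[ℂ] (ℂ × ℂ)) :
    pairing₂ (a + a') b z = pairing₂ a b z + pairing₂ a' b z := by
  induction z with
  | zero => simp
  | add x y hx hy => simp only [map_add, hx, hy]; ring
  | tmul x y => simp only [pairing₂_tmul, map_add, LinearMap.add_apply]; ring

theorem pairing₂_add_right (a b b' : ℂ × ℂ) (z : (ℂ × ℂ) ⊗[ℂ] (ℂ × ℂ)) :
    pairing₂ a (b + b') z = pairing₂ a b z + pairing₂ a b' z := by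
  induction z with
  | zero => simp
  | add x y hx hy => simp only [map_add, hx, hy]; ring
  | tmul x y => simp only [pairing₂_tmul, map_add, LinearMap.add_apply]; ring

theorem pairing₂_smul_left (c : ℂ) (a b : ℂ × ℂ) (z : (ℂ × ℂ) ⊗[ℂ] (ℂ × ℂ)) :
    pairing₂ (c • a) b z = c * pairing₂ a b z := by
  induction z with
  | zero => simp
  | add x y hx hy => simp only [map_add, hx, hy]; ring
  | tmul x y => simp only [pairing₂_tmul, map_smul, LinearMap.smul_apply, smul_eq_mul]; ring

theorem pairing₂_smul_right (c : ℂ) (a b : ℂ × ℂ) (z : (ℂ × ℂ) ⊗[ℂ] (ℂ × ℂ)) :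
    pairing₂ a (c • b) z = c * pairing₂ a b z := by
  induction z with
  | zero => simp
  | add x y hx hy => simp only [map_add, hx, hy]; ring
  | tmul x y => simp only [pairing₂_tmul, map_smul, LinearMap.smul_apply, smul_eq_mul]; ring

/-- The product dual to a coproduct `ℂ² → ℂ² ⊗ ℂ²`. -/
noncomputable def dualProduct (T : ℂ × ℂ →ₗ[ℂ] (ℂ × ℂ) ⊗[ℂ] (ℂ × ℂ)) :
    ℂ × ℂ →ₗ[ℂ] ℂ × ℂ →ₗ[ℂ] ℂ × ℂ :=
  LinearMap.mk₂ ℂ (fun a b => (pairing₂ a b (T (1, 0)), pairing₂ a b (T (0, 1))))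
    (fun _ _ _ => by simp [pairing₂_add_left]) (fun _ _ _ => by simp [pairing₂_smul_left])
    (fun _ _ _ => by simp [pairing₂_add_right]) (fun _ _ _ => by simp [pairing₂_smul_right])

theorem pairing_dualProduct (T : ℂ × ℂ →ₗ[ℂ] (ℂ × ℂ) ⊗[ℂ] (ℂ × ℂ)) (a b x : ℂ × ℂ) :
    pairing (dualProduct T a b) x = pairing₂ a b (T x) := by
  rw [apply_eq_coords T x]
  simp [dualProduct]
  ring

/-- The two standard lists are transposes of each other, label by label. -/
theorem pairing_stdMul (i : StdLabel) (s : ℕ+) (a b x : ℂ × ℂ) :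
    pairing (stdMul i s a b) x = pairing₂ a b (stdβ i s x) := by
  rw [stdβ_apply]
  cases i with
  | two =>
    by_cases hs : Even (s : ℕ) <;> simp [stdMul, stdβ₁, stdβ₂, stdE₁, stdE₂, hs] <;> ring
  | _ =>
    simp [stdMul, stdβ₁, stdβ₂, stdE₁, stdE₂]
    ring

/-- The linear functional `x ⊗ (y ⊗ z) ↦ ⟨a, x⟩ ⟨b, y⟩ ⟨c, z⟩`. -/
noncomputable def pairing₃ (a b c : ℂ × ℂ) :
    (ℂ × ℂ) ⊗[ℂ] ((ℂ × ℂ) ⊗[ℂ] (ℂ × ℂ)) →ₗ[ℂ] ℂ :=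
  TensorProduct.lift ((LinearMap.mul ℂ ℂ).compl₁₂ (pairing a) (pairing₂ b c))

@[simp] theorem pairing₃_tmul (a b c x : ℂ × ℂ) (y : (ℂ × ℂ) ⊗[ℂ] (ℂ × ℂ)) :
    pairing₃ a b c (x ⊗ₜ y) = pairing a x * pairing₂ b c y := rfl

theorem pairing₂_dualProduct_left (T : ℂ × ℂ →ₗ[ℂ] (ℂ × ℂ) ⊗[ℂ] (ℂ × ℂ)) (a b c : ℂ × ℂ)
    (z : (ℂ × ℂ) ⊗[ℂ] (ℂ × ℂ)) :
    pairing₂ (dualProduct T a b) c z = pairing₃ a b c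
      (TensorProduct.assoc ℂ (ℂ × ℂ) (ℂ × ℂ) (ℂ × ℂ) (T.rTensor (ℂ × ℂ) z)) := by
  induction z with
  | zero => simp
  | add x y hx hy => simp only [map_add, hx, hy]
  | tmul x y =>
    rw [pairing₂_tmul, pairing_dualProduct, LinearMap.rTensor_tmul]
    induction T x with
    | zero => simp
    | add z w hz hw => simp only [map_add, TensorProduct.add_tmul, add_mul, hz, hw]
    | tmul z w => simp only [pairing₂_tmul, TensorProduct.assoc_tmul, pairing₃_tmul, mul_assoc]

theorem pairing₂_dualProduct_right (T : ℂ × ℂ →ₗ[ℂ] (ℂ × ℂ) ⊗[ℂ] (ℂ × ℂ)) (a b c : ℂ × ℂ)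
    (z : (ℂ × ℂ) ⊗[ℂ] (ℂ × ℂ)) :
    pairing₂ a (dualProduct T b c) z = pairing₃ a b c (T.lTensor (ℂ × ℂ) z) := by
  induction z with
  | zero => simp
  | add x y hx hy => simp only [map_add, hx, hy]
  | tmul x y => simp only [pairing₂_tmul, pairing_dualProduct, LinearMap.lTensor_tmul,
      pairing₃_tmul]

/-- The inverse transpose of `θ`. Passing to it turns isomorphisms of coproducts into isomorphisms
of the dual products in the same direction, and conversely. -/
theorem exists_contragredient (θ : (ℂ × ℂ) ≃ₗ[ℂ] ℂ × ℂ) :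
    ∃ φ : (ℂ × ℂ) ≃ₗ[ℂ] ℂ × ℂ, ∀ a x, pairing (θ a) (φ x) = pairing a x := by
  let f : ℂ × ℂ →ₗ[ℂ] ℂ × ℂ :=
    (pairing (θ.symm (1, 0))).prod (pairing (θ.symm (0, 1)))
  have hf : ∀ x b, pairing b (f x) = pairing (θ.symm b) x := by
    intro x b
    have : f x = (pairing (θ.symm (1, 0)) x, pairing (θ.symm (0, 1)) x) := rfl
    rw [this, ← LinearEquiv.coe_coe, apply_eq_coords θ.symm.toLinearMap b]
    simp
  have hinj : Function.Injective f := fun x y hxy => eq_of_pairing fun a => by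
    have h := hf x (θ a)
    rw [hxy, hf y, LinearEquiv.symm_apply_apply] at h
    rw [pairing_comm, pairing_comm y, h]
  refine ⟨LinearEquiv.ofInjectiveEndo f hinj, fun a x => ?_⟩
  rw [LinearEquiv.coe_ofInjectiveEndo, hf, LinearEquiv.symm_apply_apply]

theorem pairing₂_contragredient {θ φ θ' φ' : (ℂ × ℂ) ≃ₗ[ℂ] ℂ × ℂ}
    (h : ∀ a x, pairing (θ a) (φ x) = pairing a x)
    (h' : ∀ a x, pairing (θ' a) (φ' x) = pairing a x) (a b : ℂ × ℂ)
    (z : (ℂ × ℂ) ⊗[ℂ] (ℂ × ℂ)) :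
    pairing₂ (θ a) (θ' b) (TensorProduct.map φ.toLinearMap φ'.toLinearMap z) =
      pairing₂ a b z := by
  induction z with
  | zero => simp
  | add x y hx hy => simp only [map_add, hx, hy]
  | tmul x y =>
    simp only [TensorProduct.map_tmul, pairing₂_tmul, LinearEquiv.coe_coe, h, h']

theorem stdSubproductSystem_eq_of_iso {i j : StdLabel}
    (f : SubproductSystemIso (stdSubproductSystem i) (stdSubproductSystem j)) : i = j := by
  let φ : ℕ+ → (ℂ × ℂ) ≃ₗ[ℂ] ℂ × ℂ := f.toEquiv
  have hφ : ∀ (s t : ℕ+) x, stdβ j s (φ (s + t) x) =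
      TensorProduct.map (φ s).toLinearMap (φ t).toLinearMap (stdβ i s x) := f.map_β
  choose θ hθ using fun t => exists_contragredient (φ t)
  have hθ' : ∀ t a x, pairing (θ t a) (φ t x) = pairing a x := fun t a x => by
    rw [pairing_comm, hθ, pairing_comm]
  refine eq_of_equivalent_std ⟨θ, fun s t a b => eq_of_pairing fun x => ?_⟩
  obtain ⟨y, rfl⟩ := (φ (s + t)).surjective x
  rw [hθ', std_apply, std_apply, pairing_stdMul, pairing_stdMul, hφ,
    pairing₂_contragredient (hθ' s) (hθ' t)]

/-! ### Classification of subproduct systems through their dual products -/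

namespace SubproductSystem

variable (S : SubproductSystem.{u}) (e : ∀ t, S.E t ≃ₗ[ℂ] ℂ × ℂ)

/-- The structure maps in the given coordinates. -/
noncomputable def coordβ (s t : ℕ+) : ℂ × ℂ →ₗ[ℂ] (ℂ × ℂ) ⊗[ℂ] (ℂ × ℂ) :=
  (TensorProduct.map (e s).toLinearMap (e t).toLinearMap) ∘ₗ S.β s t ∘ₗ
    (e (s + t)).symm.toLinearMap

theorem coordβ_apply (s t : ℕ+) (x : S.E (s + t)) : S.coordβ e s t (e (s + t) x) =
    TensorProduct.map (e s).toLinearMap (e t).toLinearMap (S.β s t x) := by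
  simp [coordβ]

theorem coordβ_injective (s t : ℕ+) : Function.Injective (S.coordβ e s t) :=
  (TensorProduct.congr (e s) (e t)).injective.comp
    ((S.injective s t).comp (e (s + t)).symm.injective)

theorem coords_cast {p q : ℕ+} (h : p = q) (x : S.E p) :
    e q (cast (congrArg S.E h) x) = e p x := by
  subst h; rfl

theorem coordβ_assoc (r s t : ℕ+) (x : ℂ × ℂ) :
    TensorProduct.assoc ℂ (ℂ × ℂ) (ℂ × ℂ) (ℂ × ℂ)
        ((S.coordβ e r s).rTensor (ℂ × ℂ) (S.coordβ e (r + s) t x)) =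
      (S.coordβ e s t).lTensor (ℂ × ℂ) (S.coordβ e r (s + t) x) := by
  obtain ⟨x, rfl⟩ := (e (r + s + t)).surjective x
  have h := congrArg (TensorProduct.map (e r).toLinearMap
    (TensorProduct.map (e s).toLinearMap (e t).toLinearMap)) (S.assoc r s t x)
  rw [coordβ_apply, ← S.coords_cast e (add_assoc r s t) x, coordβ_apply]
  have h1 : ∀ z, TensorProduct.assoc ℂ (ℂ × ℂ) (ℂ × ℂ) (ℂ × ℂ)
      ((S.coordβ e r s).rTensor (ℂ × ℂ)
        (TensorProduct.map (e (r + s)).toLinearMap (e t).toLinearMap z)) =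
      TensorProduct.map (e r).toLinearMap
        (TensorProduct.map (e s).toLinearMap (e t).toLinearMap)
        (TensorProduct.assoc ℂ (S.E r) (S.E s) (S.E t) ((S.β r s).rTensor (S.E t) z)) := by
    intro z
    induction z with
    | zero => simp
    | add x y hx hy => simp only [map_add, hx, hy]
    | tmul x y =>
      simp only [TensorProduct.map_tmul, LinearMap.rTensor_tmul, LinearEquiv.coe_coe,
        coordβ_apply]
      induction S.β r s x with
      | zero => simp
      | add z w hz hw => simp only [map_add, TensorProduct.add_tmul, hz, hw]
      | tmul z w => simp
  have h2 : ∀ z, (S.coordβ e s t).lTensor (ℂ × ℂ)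
      (TensorProduct.map (e r).toLinearMap (e (s + t)).toLinearMap z) =
      TensorProduct.map (e r).toLinearMap
        (TensorProduct.map (e s).toLinearMap (e t).toLinearMap) ((S.β s t).lTensor (S.E r) z) := by
    intro z
    induction z with
    | zero => simp
    | add x y hx hy => simp only [map_add, hx, hy]
    | tmul x y =>
      simp only [TensorProduct.map_tmul, LinearMap.lTensor_tmul, LinearEquiv.coe_coe,
        coordβ_apply]
  rw [h1, h2, h]

/-- The dual family of products. -/
noncomputable def dualFamily : ProductFamily := fun s t => dualProduct (S.coordβ e s t)

/-- Coassociativity, tested against $a\otimes b\otimes c$, is associativity. If $x$ is orthogonal to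
all products, every functional $a\otimes b$ vanishes on the coproduct of $x$, so $x=0$ by
injectivity. -/
theorem isTwoDim_dualFamily : (S.dualFamily e).IsTwoDim where
  assoc r s t a b c := eq_of_pairing fun x => by
    simp only [dualFamily, pairing_dualProduct, pairing₂_dualProduct_left,
      pairing₂_dualProduct_right, coordβ_assoc]
  nondegenerate s t x h := S.coordβ_injective e s t (eq_of_pairing₂ fun a b => by
    rw [← pairing_dualProduct, map_zero, map_zero]
    exact h a b)

theorem exists_iso : ∃ i, Nonempty (SubproductSystemIso S (stdSubproductSystem i)) := by
  have he : ∀ t : ℕ+, Nonempty (S.E t ≃ₗ[ℂ] ℂ × ℂ) := fun t => by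
    have h := S.finrank_eq_two t
    have : Module.Finite ℂ (S.E t) := Module.finite_of_finrank_pos (by omega)
    exact ⟨LinearEquiv.ofFinrankEq _ _ (by simp [h])⟩
  let e := fun t => (he t).some
  obtain ⟨i, θ, hθ⟩ := exists_equivalent_std (S.isTwoDim_dualFamily e)
  choose φ hφ using fun t => exists_contragredient (θ t)
  refine ⟨i, ⟨fun t => (e t).trans (φ t), fun s t x => ?_⟩⟩
  have key : stdβ i s (φ (s + t) (e (s + t) x)) =
      TensorProduct.map (φ s).toLinearMap (φ t).toLinearMap
        (S.coordβ e s t (e (s + t) x)) := eq_of_pairing₂ fun a b => by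
    obtain ⟨a, rfl⟩ := (θ s).surjective a
    obtain ⟨b, rfl⟩ := (θ t).surjective b
    rw [pairing₂_contragredient (hφ s) (hφ t), ← pairing_stdMul, ← pairing_dualProduct]
    exact (congrArg (pairing · _) (hθ s t a b).symm).trans (hφ (s + t) _ _)
  refine key.trans ?_
  rw [coordβ_apply, ← LinearMap.comp_apply, ← TensorProduct.map_comp]
  rfl

end SubproductSystem

theorem mainTheorem2 :
    -- The standard graded algebras satisfy the conditions
    (∀ i : StdLabel, IsTwoDimGradedAlgebra (StdAlg i)) ∧
    -- and every graded algebra that does is isomorphic to one and only one of them,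
    (∀ (A : ℕ → Type u) [∀ n, AddCommGroup (A n)] [∀ n, Module ℂ (A n)]
        [DirectSum.GRing A] [DirectSum.GAlgebra ℂ A],
      IsTwoDimGradedAlgebra A →
        ∃! i : StdLabel, Nonempty (GradedAlgebraIso A (StdAlg i))) ∧
    -- which are pairwise non-isomorphic.
    (∀ i j : StdLabel, Nonempty (GradedAlgebraIso (StdAlg i) (StdAlg j)) → i = j) ∧
    -- Every subproduct system is isomorphic to one and only one of the standard ones,
    (∀ S : SubproductSystem.{v},
      ∃! i : StdLabel, Nonempty (SubproductSystemIso S (stdSubproductSystem i))) ∧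
    -- which are pairwise non-isomorphic.
    (∀ i j : StdLabel,
      Nonempty (SubproductSystemIso (stdSubproductSystem i) (stdSubproductSystem j)) →
        i = j) := by
  refine ⟨StdAlg.isTwoDimGradedAlgebra, fun A _ _ _ _ hA => ?_,
    fun i j ⟨f⟩ => StdAlg.eq_of_iso f, fun S => ?_,
    fun i j ⟨f⟩ => stdSubproductSystem_eq_of_iso f⟩
  · obtain ⟨i, ⟨f⟩⟩ := exists_graded_iso hA
    exact ⟨i, ⟨f⟩, fun j ⟨g⟩ => StdAlg.eq_of_iso (g.symm.trans f)⟩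
  · obtain ⟨i, ⟨f⟩⟩ := S.exists_iso
    exact ⟨i, ⟨f⟩, fun j ⟨g⟩ => stdSubproductSystem_eq_of_iso (g.symm.trans f)⟩
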